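/- For every $\epsilon>0$ and every real $K$ there is a constant $C=C(\epsilon,K)$ with the following property. Let $0<\alpha<1$, and let $f:\mathbb{N}\to[0,\infty)$ be a multiplicative function such that $f(p)\leq 1$ and $f(p^m)\leq f(p)$ for all primes $p$ and all $m\geq 2$, and such that for all real $X\geq 2$ $$\Bigl|\sum_{p\leq X}\frac{f(p)}{p}-\alpha\log\log X\Bigr|\leq K,$$ where the sum is over primes. Then for all real numbers $M\geq N\geq W\geq 2$ and all complex sequences $(a_n)$, $(b_m)$ supported on the odd integers with $|a_n|\leq 1$ and $|b_m|\leq 1$, $$\Bigl|\sum_{W<n\leq N}\ \sum_{1\leq m\leq M}\frac{a_n}{n}\,b_m f(m)\left(\frac{n}{m}\right)\Bigr|\leq C\left(\frac{M\log N}{W^{1/2}(\log M)^{1-\alpha}}+\frac{M^{1/2+\epsilon}N^{1/2}(\log N)^{1/2}}{(\log M)^{(1-\alpha)/2}}\right),$$ where $\left(\frac{n}{m}\right)$ is the Jacobi symbol. In particular, $C$ does not depend on $\alpha$, $f$, $M$, $N$, $W$ or the sequences. -/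

import Mathlib

/-! ### The Pólya–Vinogradov inequality -/

section PolyaVinogradov

variable {N : ℕ} [NeZero N]

/-! The proof is Cauchy–Schwarz in `m` against a sieve majorant `F` of `f`, followed by
Pólya–Vinogradov on the off-diagonal.

By multiplicativity, `f m` is at most the product of `f p` over the odd primes `p ≤ z` dividing `m`.
That product is the probability that `m` survives when the multiples of each `p` are removed
independently with probability `1 - f p`. Averaging Selberg's squared weights over these choices
gives a majorant `F` supported on divisibility conditions. Its mean over odd `m ≤ M` is `1 / (2G)`
up to the sieve error (`sum_selbergMajorant_le`), and `G ≫ (log z) ^ (1 - α)` by Mertens and the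
hypothesis on `f p / p` (`selbergG_oddPrimes_ge`). So `F` has total mass `T ≪ M / (log M) ^ (1 -
α)`, which is where the saving comes from.

Now `|S|² ≤ T · ∑ F(m) |A m|²`, where `A m` is the sum over `n`. Opening the square gives pairs `i,
j` weighted by `1 / (i j)` and the sum of `F(m)` times the symbol of `i j` at `m`. If `i j` is a
square the inner sum is at most `T`; such pairs have total weight `≪ log N / W`
(`sum_square_pairs_le`), which produces the first term of the bound. Otherwise, expanding `F` and
applying reciprocity and Pólya–Vinogradov (`abs_sum_odd_jacobiSym_le`) bounds it by `D ^ 4 √(i j)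
log N` up to a constant, which produces the second term. The level `D` is a small power of `M`, so
that `D ^ 4 ≤ M ^ (2ε)`. -/

theorem normSq_gaussSum_of_isPrimitive {χ : DirichletCharacter ℂ N} (hχ : χ.IsPrimitive) :
    ‖gaussSum χ (ZMod.stdAddChar (N := N))‖ ^ 2 = N := by
  set e := ZMod.stdAddChar (N := N) with he
  -- The second factor is the complex conjugate of the first. Primitivity absorbs `χ⁻¹ x` into a
  -- shift of the additive character for every `x`, units or not; orthogonality then leaves only `y
  -- = 1`.
  have h1 : gaussSum χ e * gaussSum χ⁻¹ e⁻¹ = N := by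
    have : gaussSum χ⁻¹ e⁻¹ = ∑ x, χ⁻¹ x * e⁻¹ x := rfl
    rw [this, Finset.mul_sum]
    calc ∑ x, gaussSum χ e * (χ⁻¹ x * e⁻¹ x)
        = ∑ x, ∑ y, χ y * e (x * (y - 1)) := by
          refine Finset.sum_congr rfl fun x _ => ?_
          have := gaussSum_mulShift_of_isPrimitive e hχ x
          rw [show gaussSum χ e * (χ⁻¹ x * e⁻¹ x) = (χ⁻¹ x * gaussSum χ e) * e⁻¹ x by ring, ← this,
            gaussSum, Finset.sum_mul]
          refine Finset.sum_congr rfl fun y _ => ?_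
          rw [AddChar.mulShift_apply, AddChar.inv_apply, mul_assoc, ← AddChar.map_add_eq_mul]
          congr 2; ring
      _ = ∑ y, χ y * ∑ x, e (x * (y - 1)) := by
          rw [Finset.sum_comm]; simp_rw [Finset.mul_sum]
      _ = ∑ y, χ y * (if y = 1 then (N : ℂ) else 0) := by
          refine Finset.sum_congr rfl fun y _ => ?_
          rw [AddChar.sum_mulShift _ (ZMod.isPrimitive_stdAddChar N)]
          simp [sub_eq_zero, ZMod.card]
      _ = N := by simp
  rw [← star_gaussSum_eq] at h1
  have h2 := Complex.mul_conj (gaussSum χ e)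
  rw [starRingEnd_apply, h1, Complex.normSq_eq_norm_sq] at h2
  exact_mod_cast h2.symm

/-- The norm is `2 sin (π y / N)`, and Jordan's inequality bounds the sine below by the distance of
`y` to the nearer of `0` and `N`. Keeping both reciprocals instead of the larger one makes the sum
over `y` two harmonic sums. -/
theorem norm_stdAddChar_sub_one_ge (y : ZMod N) (hy : y ≠ 0) :
    (2 : ℝ) / ‖ZMod.stdAddChar y - 1‖ ≤ N / 2 * (1 / y.val + 1 / (N - y.val : ℝ)) := by
  have hN : (0 : ℝ) < N := by exact_mod_cast NeZero.pos N
  have hv0 : (0 : ℝ) < y.val := by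
    exact_mod_cast Nat.pos_of_ne_zero ((ZMod.val_ne_zero y).mpr hy)
  have hvN : (y.val : ℝ) < N := by exact_mod_cast y.val_lt
  have hnorm : ‖ZMod.stdAddChar y - 1‖ = 2 * Real.sin (Real.pi * y.val / N) := by
    have h := ZMod.stdAddChar_coe (N := N) (y.val : ℤ)
    rw [Int.cast_natCast, ZMod.natCast_zmod_val] at h
    rw [h, show (2 * (Real.pi : ℂ) * Complex.I * ((y.val : ℤ) : ℂ) / N)
      = Complex.I * ((2 * Real.pi * y.val / N : ℝ) : ℂ) by push_cast; ring,
      Complex.norm_exp_I_mul_ofReal_sub_one, Real.norm_eq_abs, abs_of_nonneg]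
    · congr 2; ring
    · have : 0 ≤ Real.sin (2 * Real.pi * y.val / N / 2) := by
        apply Real.sin_nonneg_of_nonneg_of_le_pi
        · positivity
        · rw [div_div, div_le_iff₀ (by positivity)]
          nlinarith [Real.pi_pos]
      positivity
  have key : ∀ t : ℝ, 0 < t → t ≤ N / 2 → 2 / N * t ≤ Real.sin (Real.pi * t / N) := by
    intro t ht htN
    have := Real.mul_le_sin (x := Real.pi * t / N) (by positivity) (by
      rw [div_le_div_iff₀ hN two_pos]; nlinarith [Real.pi_pos])
    calc 2 / N * t = 2 / Real.pi * (Real.pi * t / N) := by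
          field_simp
      _ ≤ _ := this
  rw [hnorm]
  have hp1 : 0 ≤ 1 / (y.val : ℝ) := by positivity
  have hp2 : 0 ≤ 1 / (N - y.val : ℝ) := by
    have : 0 < (N - y.val : ℝ) := by linarith
    positivity
  have fin : ∀ t : ℝ, 0 < t → 2 / N * t ≤ Real.sin (Real.pi * y.val / N) →
      2 / (2 * Real.sin (Real.pi * y.val / N)) ≤ N / 2 * (1 / t) := by
    intro t ht h
    have : 0 < 2 / N * t := by positivity
    calc 2 / (2 * Real.sin (Real.pi * y.val / N)) ≤ 2 / (2 * (2 / N * t)) := by gcongr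
      _ = _ := by field_simp
  rcases le_total (y.val : ℝ) (N / 2) with h | h
  · refine (fin _ hv0 (key _ hv0 h)).trans ?_
    gcongr; linarith
  · have h3 : 0 < (N - y.val : ℝ) := by linarith
    refine (fin _ h3 ?_).trans ?_
    · have := key _ h3 (by linarith)
      rwa [show Real.pi * (N - y.val : ℝ) / N = Real.pi - Real.pi * y.val / N by field_simp,
        Real.sin_pi_sub] at this
    · gcongr; linarith

theorem sum_inv_norm_stdAddChar_sub_one_le :
    ∑ y ∈ Finset.univ.filter (fun y : ZMod N => y ≠ 0), (2 : ℝ) / ‖ZMod.stdAddChar y - 1‖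
      ≤ N * (1 + Real.log N) := by
  have hN : (0 : ℝ) < N := by exact_mod_cast NeZero.pos N
  calc _ ≤ ∑ y ∈ Finset.univ.filter (fun y : ZMod N => y ≠ 0),
        ((N : ℝ) / 2 * (1 / y.val + 1 / (N - y.val : ℝ))) := by
        refine Finset.sum_le_sum fun y hy => norm_stdAddChar_sub_one_ge y (Finset.mem_filter.1 hy).2
    _ = ∑ v ∈ Finset.Ico 1 N, ((N : ℝ) / 2 * (1 / v + 1 / (N - v : ℝ))) := by
        refine Finset.sum_bij (fun y _ => y.val) ?_ ?_ ?_ ?_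
        · intro y hy
          have := (ZMod.val_ne_zero y).mpr (Finset.mem_filter.1 hy).2
          have := y.val_lt
          simp; omega
        · intro y _ y' _ h; exact ZMod.val_injective N h
        · intro v hv
          rw [Finset.mem_Ico] at hv
          refine ⟨(v : ZMod N), ?_, ZMod.val_cast_of_lt hv.2⟩
          simp only [Finset.mem_filter, Finset.mem_univ, true_and]
          rw [← ZMod.val_ne_zero, ZMod.val_cast_of_lt hv.2]; omega
        · intro y _; rfl
    _ = (N : ℝ) / 2 * (∑ v ∈ Finset.Ico 1 N, 1 / (v : ℝ) + ∑ v ∈ Finset.Ico 1 N, 1 / (v : ℝ)) := by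
        rw [← Finset.mul_sum, Finset.sum_add_distrib]
        congr 2
        refine Finset.sum_bij (fun v _ => N - v) ?_ ?_ ?_ ?_
        · intro v hv; simp at hv ⊢; omega
        · intro v hv v' hv' h; simp at hv hv' h; omega
        · intro v hv; simp at hv; exact ⟨N - v, by simp; omega, by omega⟩
        · intro v hv; simp at hv; rw [Nat.cast_sub hv.2.le]
    _ ≤ (N : ℝ) * (1 + Real.log N) := by
        have h1 := harmonic_le_one_add_log N
        have h2 : ∑ v ∈ Finset.Ico 1 N, 1 / (v : ℝ) ≤ (harmonic N : ℝ) := by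
          rw [harmonic_eq_sum_Icc]; push_cast
          simp_rw [one_div]
          refine Finset.sum_le_sum_of_subset_of_nonneg ?_ fun i _ _ => by positivity
          intro i hi; simp at hi ⊢; omega
        nlinarith

theorem norm_sum_range_stdAddChar_le (a y : ZMod N) (hy : y ≠ 0) (n : ℕ) :
    ‖∑ i ∈ Finset.range n, ZMod.stdAddChar ((a + (i : ZMod N)) * y)‖ ≤ 2 / ‖ZMod.stdAddChar y - 1‖ := by
  set e := ZMod.stdAddChar (N := N)
  have hne : e y ≠ 1 := by
    have := ZMod.injective_stdAddChar (N := N)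
    intro h
    exact hy (this (by rw [h, AddChar.map_zero_eq_one]))
  have h1 : ∀ i ∈ Finset.range n, e ((a + i) * y) = e (a * y) * e y ^ i := by
    intro i _
    rw [← AddChar.map_nsmul_eq_pow, ← AddChar.map_add_eq_mul]
    congr 1; rw [nsmul_eq_mul]; ring
  rw [Finset.sum_congr rfl h1, ← Finset.mul_sum, geom_sum_eq hne, norm_mul, AddChar.norm_apply,
    one_mul, norm_div]
  gcongr
  refine (norm_sub_le _ _).trans ?_
  rw [norm_pow, AddChar.norm_apply]; norm_num

/-- The **Pólya–Vinogradov inequality** for (the inverse of) a primitive character. -/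
theorem norm_sum_range_inv_le_of_isPrimitive (hN : 1 < N) {χ : DirichletCharacter ℂ N}
    (hχ : χ.IsPrimitive) (a : ZMod N) (n : ℕ) :
    ‖∑ i ∈ Finset.range n, χ⁻¹ (a + i)‖ ≤ √N * (1 + Real.log N) := by
  set e := ZMod.stdAddChar (N := N) with he
  set G := gaussSum χ e with hG
  have hN0 : (0 : ℝ) < N := by exact_mod_cast NeZero.pos N
  have hGn : ‖G‖ = √N := by
    rw [← normSq_gaussSum_of_isPrimitive hχ, Real.sqrt_sq (norm_nonneg _)]
  -- Completion: the shift identity for primitive characters turns the incomplete character sum into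
  -- geometric sums, one for each frequency `y`. The frequency `y = 0` drops out because `χ 0 = 0`.
  have h1 : (∑ i ∈ Finset.range n, χ⁻¹ (a + i)) * G
      = ∑ y, χ y * ∑ i ∈ Finset.range n, e ((a + i) * y) := by
    rw [Finset.sum_mul]
    simp_rw [Finset.mul_sum]
    rw [Finset.sum_comm]
    refine Finset.sum_congr rfl fun i _ => ?_
    rw [← gaussSum_mulShift_of_isPrimitive e hχ, gaussSum]
    rfl
  have h2 : ‖∑ i ∈ Finset.range n, χ⁻¹ (a + i)‖ * √N ≤ N * (1 + Real.log N) := by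
    rw [← hGn, ← norm_mul, h1]
    refine le_trans ?_ sum_inv_norm_stdAddChar_sub_one_le
    rw [Finset.sum_filter]
    refine (norm_sum_le _ _).trans (Finset.sum_le_sum fun y _ => ?_)
    split_ifs with hy
    · rw [norm_mul]
      calc _ ≤ 1 * ‖∑ i ∈ Finset.range n, e ((a + i) * y)‖ := by
            gcongr; exact χ.norm_le_one y
        _ ≤ _ := by rw [one_mul]; exact norm_sum_range_stdAddChar_le a y hy n
    · push Not at hy
      have : Fact (1 < N) := ⟨hN⟩
      rw [hy, MulChar.map_zero]; simp
  have h3 : 0 < √(N : ℝ) := Real.sqrt_pos.mpr hN0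
  rw [← mul_le_mul_iff_left₀ h3]
  calc _ ≤ _ := h2
    _ = (√N * √N) * (1 + Real.log N) := by rw [Real.mul_self_sqrt hN0.le]
    _ = _ := by ring

end PolyaVinogradov

/-! ### Sums of Jacobi symbols -/

section JacobiSums

/-- The Jacobi symbol modulo `k` as a Dirichlet character. -/
noncomputable def jacobiChar (k : ℕ) [NeZero k] : DirichletCharacter ℂ k where
  toFun x := (jacobiSym (x.val : ℤ) k : ℂ)
  map_one' := by
    have h : jacobiSym ((1 : ZMod k).val : ℤ) k = jacobiSym 1 k := by
      apply jacobiSym.mod_left'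
      have : ((1 : ZMod k).val : ℤ) = ((1 : ℤ) % k) := by
        have := ZMod.val_natCast k 1
        rw [Nat.cast_one] at this
        rw [this]; push_cast; rfl
      rw [this, Int.emod_emod_of_dvd _ dvd_rfl]
    rw [h, jacobiSym.one_left, Int.cast_one]
  map_mul' x y := by
    rw [← Int.cast_mul, ← jacobiSym.mul_left]
    congr 1
    apply jacobiSym.mod_left'
    rw [ZMod.val_mul]; push_cast; rw [Int.emod_emod_of_dvd _ dvd_rfl]
  map_nonunit' x hx := by
    have : ¬ x.val.Coprime k := by
      intro h
      apply hx
      rw [← ZMod.natCast_zmod_val x]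
      exact (ZMod.isUnit_iff_coprime _ _).mpr h
    have h2 : jacobiSym (x.val : ℤ) k = 0 := by
      rw [jacobiSym.eq_zero_iff_not_coprime]
      rwa [Int.gcd_natCast_natCast]
    rw [h2, Int.cast_zero]

theorem jacobiChar_natCast (k : ℕ) [NeZero k] (n : ℕ) :
    jacobiChar k (n : ZMod k) = (jacobiSym (n : ℤ) k : ℂ) := by
  change ((jacobiSym (((n : ZMod k).val : ℕ) : ℤ) k : ℤ) : ℂ) = _
  congr 1
  rw [ZMod.val_natCast, jacobiSym.mod_left (n : ℤ)]; push_cast; rfl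

theorem jacobiChar_inv (k : ℕ) [NeZero k] : (jacobiChar k)⁻¹ = jacobiChar k := by
  apply MulChar.IsQuadratic.inv
  intro x
  rw [← ZMod.natCast_zmod_val x, jacobiChar_natCast]
  rcases jacobiSym.trichotomy (x.val : ℤ) k with h | h | h <;> rw [h] <;> simp

/-- If the conductor `d` were proper, some prime `p` would divide `k / d`. As `k` is squarefree, `p`
is coprime to the rest of `k`, and `p` is odd, so by the Chinese remainder theorem there is a `t`
that is a nonresidue mod `p` and `1` modulo `k / p`. It is trivial mod `d` yet has symbol `-1`. -/
theorem jacobiChar_isPrimitive {k : ℕ} [NeZero k] (hk : Squarefree k) (hodd : Odd k) :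
    (jacobiChar k).IsPrimitive := by
  rw [DirichletCharacter.isPrimitive_def]
  set d := (jacobiChar k).conductor with hd
  have hdk : d ∣ k := DirichletCharacter.conductor_dvd_level _
  have hfac : (jacobiChar k).FactorsThrough d := DirichletCharacter.factorsThrough_conductor _
  by_contra hne
  obtain ⟨e, he⟩ := hdk
  have he1 : e ≠ 1 := by rintro rfl; exact hne (by rw [mul_one] at he; exact he.symm)
  obtain ⟨p, hp, q, rfl⟩ := Nat.exists_prime_and_dvd he1
  have hp' : Fact p.Prime := ⟨hp⟩
  have hkp : k = p * (d * q) := by rw [he]; ring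
  have hcop : p.Coprime (d * q) := by
    have := hk; rw [hkp] at this; exact Nat.coprime_of_squarefree_mul this
  have hp2 : p ≠ 2 := by
    rintro rfl
    rw [hkp] at hodd
    exact absurd (Nat.odd_mul.mp hodd).1 (by decide)
  obtain ⟨r, hr⟩ := FiniteField.exists_nonsquare (F := ZMod p) (by rwa [ZMod.ringChar_zmod_n])
  obtain ⟨t, ht1, ht2⟩ := Nat.chineseRemainder hcop r.val 1
  have htr : (t : ZMod p) = r := by
    rw [← ZMod.natCast_zmod_val r]; exact (ZMod.natCast_eq_natCast_iff _ _ _).mpr ht1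
  have hJp : jacobiSym (t : ℤ) p = -1 := by
    rw [← jacobiSym.legendreSym.to_jacobiSym, legendreSym.eq_neg_one_iff]
    rwa [Int.cast_natCast, htr]
  have hNq : NeZero (d * q) := ⟨by rintro h; rw [h, mul_zero] at hkp; exact NeZero.ne k hkp⟩
  have hJq : jacobiSym (t : ℤ) (d * q) = 1 := by
    have : jacobiSym (t : ℤ) (d * q) = jacobiSym (1 : ℤ) (d * q) := by
      apply jacobiSym.mod_left'
      have := ht2
      unfold Nat.ModEq at this
      exact_mod_cast this
    rw [this, jacobiSym.one_left]
  have hNp : NeZero p := ⟨hp.ne_zero⟩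
  have hJ : jacobiSym (t : ℤ) k = -1 := by
    rw [hkp, jacobiSym.mul_right, hJp, hJq]; rfl
  have htk : t.Coprime k := by
    by_contra h
    have : jacobiSym (t : ℤ) k = 0 := by
      rw [jacobiSym.eq_zero_iff_not_coprime]; simpa [Int.gcd_natCast_natCast] using h
    rw [this] at hJ; omega
  have hdk : d ∣ k := ⟨_, he⟩
  have hker := (DirichletCharacter.factorsThrough_iff_ker_unitsMap hdk).mp hfac
  have hmem : ZMod.unitOfCoprime t htk ∈ (ZMod.unitsMap hdk).ker := by
    rw [MonoidHom.mem_ker, ← Units.val_inj, ZMod.unitsMap_def, Units.coe_map,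
      ZMod.coe_unitOfCoprime]
    simp only [Units.val_one, MonoidHom.coe_coe, map_natCast]
    rw [← Nat.cast_one]
    exact (ZMod.natCast_eq_natCast_iff _ _ _).mpr (ht2.of_dvd (Dvd.intro _ rfl))
  have := hker hmem
  rw [MonoidHom.mem_ker, ← Units.val_inj, MulChar.coe_toUnitHom, ZMod.coe_unitOfCoprime,
    jacobiChar_natCast, hJ] at this
  norm_num at this

theorem abs_sum_range_jacobiSym_le {k : ℕ} (hk : Squarefree k) (hodd : Odd k) (hk1 : 1 < k)
    (a n : ℕ) :
    |∑ i ∈ Finset.range n, (jacobiSym ((a + i : ℕ) : ℤ) k : ℝ)| ≤ √k * (1 + Real.log k) := by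
  have : NeZero k := ⟨by omega⟩
  have h := norm_sum_range_inv_le_of_isPrimitive hk1 (jacobiChar_isPrimitive hk hodd) (a : ZMod k) n
  rw [jacobiChar_inv] at h
  rw [← Real.norm_eq_abs, ← Complex.norm_real]
  convert h using 2
  push_cast
  refine Finset.sum_congr rfl fun i _ => ?_
  have e := jacobiChar_natCast k (a + i)
  push_cast at e ⊢
  exact e.symm

theorem sum_filter_odd_Icc (g : ℕ → ℝ) (X : ℕ) :
    ∑ m ∈ (Finset.Icc 1 X).filter Odd, g m
      = ∑ t ∈ Finset.range ((X + 3) / 4), g (4 * t + 1)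
        + ∑ t ∈ Finset.range ((X + 1) / 4), g (4 * t + 3) := by
  induction X with
  | zero => simp
  | succ X ih =>
    rw [← Finset.insert_Icc_right_eq_Icc_add_one (by omega), Finset.filter_insert]
    have hni : X + 1 ∉ (Finset.Icc 1 X).filter Odd := by simp
    obtain ⟨q, h | h | h | h⟩ : ∃ q, X = 4 * q ∨ X = 4 * q + 1 ∨ X = 4 * q + 2 ∨ X = 4 * q + 3 :=
      ⟨X / 4, by omega⟩
    · rw [if_pos (by rw [Nat.odd_iff]; omega), Finset.sum_insert hni, ih,
        show (X + 1 + 3) / 4 = q + 1 by omega, show (X + 3) / 4 = q by omega,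
        show (X + 1 + 1) / 4 = q by omega, show (X + 1) / 4 = q by omega, Finset.sum_range_succ, h]
      ring
    · rw [if_neg (by rw [Nat.odd_iff]; omega), ih,
        show (X + 1 + 3) / 4 = (X + 3) / 4 by omega, show (X + 1 + 1) / 4 = (X + 1) / 4 by omega]
    · rw [if_pos (by rw [Nat.odd_iff]; omega), Finset.sum_insert hni, ih,
        show (X + 1 + 3) / 4 = q + 1 by omega, show (X + 3) / 4 = q + 1 by omega,
        show (X + 1 + 1) / 4 = q + 1 by omega, show (X + 1) / 4 = q by omega,
        Finset.sum_range_succ (fun t => g (4 * t + 3)), h]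
      ring
    · rw [if_neg (by rw [Nat.odd_iff]; omega), ih,
        show (X + 1 + 3) / 4 = (X + 3) / 4 by omega, show (X + 1 + 1) / 4 = (X + 1) / 4 by omega]

theorem sum_filter_odd_dvd_Icc (g : ℕ → ℝ) {d : ℕ} (hd : Odd d) (X : ℕ) :
    ∑ m ∈ (Finset.Icc 1 X).filter Odd, (if d ∣ m then g m else 0)
      = ∑ m ∈ (Finset.Icc 1 (X / d)).filter Odd, g (d * m) := by
  have hd0 : 0 < d := hd.pos
  rw [← Finset.sum_filter]
  symm
  refine Finset.sum_bij (fun m _ => d * m) ?_ ?_ ?_ ?_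
  · intro m hm
    simp only [Finset.mem_filter, Finset.mem_Icc] at hm ⊢
    refine ⟨⟨⟨Nat.mul_pos hd0 hm.1.1, ?_⟩, hd.mul hm.2⟩, Dvd.intro _ rfl⟩
    rw [mul_comm]; exact (Nat.le_div_iff_mul_le hd0).mp hm.1.2
  · intro m _ m' _ h; exact Nat.eq_of_mul_eq_mul_left hd0 h
  · intro m hm
    simp only [Finset.mem_filter, Finset.mem_Icc] at hm
    obtain ⟨⟨⟨h1, h2⟩, h3⟩, q, rfl⟩ := hm
    refine ⟨q, ?_, rfl⟩
    simp only [Finset.mem_filter, Finset.mem_Icc]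
    refine ⟨⟨Nat.pos_of_mul_pos_left h1, ?_⟩, (Nat.odd_mul.mp h3).2⟩
    rw [Nat.le_div_iff_mul_le hd0, mul_comm]; exact h2
  · intro m _; rfl

/-- On each class `m ≡ 1, 3` mod 4, reciprocity flips the symbol with a constant sign. Dividing `4 t
+ j` by `4` modulo `k`, which is harmless since `4` is a square, makes the arguments consecutive, so
Pólya–Vinogradov applies to each class. -/
theorem abs_sum_odd_jacobiSym_le_of_squarefree {k : ℕ} (hk : Squarefree k) (hodd : Odd k)
    (hk1 : 1 < k) (X : ℕ) :
    |∑ m ∈ (Finset.Icc 1 X).filter Odd, (jacobiSym (k : ℤ) m : ℝ)|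
      ≤ 2 * (√k * (1 + Real.log k)) := by
  -- `c` is the inverse of `4` modulo `k`.
  obtain ⟨c, s, hc⟩ : ∃ c s : ℕ, 4 * c = s * k + 1 := by
    have : k % 4 = 1 ∨ k % 4 = 3 := by rcases hodd with ⟨j, rfl⟩; omega
    rcases this with h | h
    · exact ⟨(3 * k + 1) / 4, 3, by omega⟩
    · exact ⟨(k + 1) / 4, 1, by omega⟩
  have hshift : ∀ t j : ℕ, jacobiSym ((4 * t + j : ℕ) : ℤ) k = jacobiSym ((j * c + t : ℕ) : ℤ) k := by
    intro t j
    have h4 : jacobiSym ((j * c + t : ℕ) : ℤ) k = jacobiSym (4 * ((j * c + t : ℕ) : ℤ)) k := by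
      rw [jacobiSym.mul_left, jacobiSym.at_four hodd, one_mul]
    rw [h4]
    apply jacobiSym.mod_left'
    have : 4 * ((j * c + t : ℕ) : ℤ) = ((4 * t + j : ℕ) : ℤ) + (j * s) * k := by
      have : (4 * c : ℤ) = s * k + 1 := by exact_mod_cast hc
      push_cast
      linear_combination (j : ℤ) * this
    rw [this, Int.add_mul_emod_self_right]
  rw [sum_filter_odd_Icc (fun m => (jacobiSym (k : ℤ) m : ℝ)), two_mul]
  refine (abs_add_le _ _).trans (add_le_add ?_ ?_)
  · have h1 : ∀ t : ℕ, (jacobiSym (k : ℤ) (4 * t + 1) : ℝ)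
        = (jacobiSym ((1 * c + t : ℕ) : ℤ) k : ℝ) := by
      intro t
      rw [← hshift, jacobiSym.quadratic_reciprocity_one_mod_four' hodd (by omega)]
    simp_rw [h1]
    exact abs_sum_range_jacobiSym_le hk hodd hk1 (1 * c) ((X + 3) / 4)
  · have h := abs_sum_range_jacobiSym_le hk hodd hk1 (3 * c) ((X + 1) / 4)
    have h3 : ∀ t : ℕ, (jacobiSym (k : ℤ) (4 * t + 3) : ℝ)
        = (if k % 4 = 3 then -1 else 1) * (jacobiSym ((3 * c + t : ℕ) : ℤ) k : ℝ) := by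
      intro t
      rw [← hshift]
      split_ifs with h
      · rw [jacobiSym.quadratic_reciprocity_three_mod_four h (by omega)]; push_cast; ring
      · have h1 : k % 4 = 1 := by rcases hodd with ⟨j, rfl⟩; omega
        rw [jacobiSym.quadratic_reciprocity_one_mod_four h1 (by rw [Nat.odd_iff]; omega)]
        push_cast; ring
    simp_rw [h3]
    rw [← Finset.mul_sum, abs_mul]
    have : |(if k % 4 = 3 then (-1 : ℝ) else 1)| = 1 := by split_ifs <;> simp
    rw [this, one_mul]; exact h

theorem sum_moebius_dvd_eq_ite_coprime {l : ℕ} (hl : l ≠ 0) (m : ℕ) :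
    ∑ d ∈ l.divisors, (if d ∣ m then (ArithmeticFunction.moebius d : ℝ) else 0)
      = if l.Coprime m then 1 else 0 := by
  have hg : (l.gcd m) ≠ 0 := Nat.gcd_ne_zero_left hl
  have h1 : l.divisors.filter (· ∣ m) = (l.gcd m).divisors := by
    ext d; simp [Nat.dvd_gcd_iff, hl]
  rw [← Finset.sum_filter, h1]
  have := congrArg (fun F : ArithmeticFunction ℤ => F (l.gcd m))
    ArithmeticFunction.moebius_mul_coe_zeta
  simp only [ArithmeticFunction.coe_mul_zeta_apply, ArithmeticFunction.one_apply] at this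
  split_ifs with h
  · rw [if_pos h] at this; exact_mod_cast this
  · rw [if_neg h] at this; exact_mod_cast this

/-- Write `κ = l² k` with `k` squarefree; `k > 1` because `κ` is not a square. The factor `l²` only
imposes coprimality to `l`, which Möbius inversion removes at the cost of one sum per divisor of
`l`. The trivial count of at most `l` divisors suffices, since `l √k = √κ`. -/
theorem abs_sum_odd_jacobiSym_le {κ : ℕ} (hodd : Odd κ) (hsq : ¬ IsSquare κ) (X : ℕ) :
    |∑ m ∈ (Finset.Icc 1 X).filter Odd, (jacobiSym (κ : ℤ) m : ℝ)|
      ≤ 2 * (√κ * (1 + Real.log κ)) := by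
  obtain ⟨k, l, rfl, hk⟩ := Nat.sq_mul_squarefree κ
  have hko : Odd k := (Nat.odd_mul.mp hodd).2
  have hlo : Odd l := by
    have := (Nat.odd_mul.mp hodd).1
    rwa [Nat.odd_pow_iff two_ne_zero] at this
  have hl0 : l ≠ 0 := hlo.pos.ne'
  have hk1 : 1 < k := by
    rcases Nat.lt_or_ge 1 k with h | h
    · exact h
    · have : k = 1 := by have := hko.pos; omega
      exact absurd ⟨l, by rw [this]; ring⟩ hsq
  have hJ : ∀ m : ℕ, m ∈ (Finset.Icc 1 X).filter Odd → (jacobiSym ((l ^ 2 * k : ℕ) : ℤ) m : ℝ)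
      = ∑ d ∈ l.divisors, (if d ∣ m then
          (ArithmeticFunction.moebius d : ℝ) * jacobiSym (k : ℤ) m else 0) := by
    intro m hm
    have hm0 : NeZero m := ⟨by simp at hm; omega⟩
    have : ∀ d, (if d ∣ m then (ArithmeticFunction.moebius d : ℝ) * jacobiSym (k : ℤ) m else 0)
        = (if d ∣ m then (ArithmeticFunction.moebius d : ℝ) else 0) * jacobiSym (k : ℤ) m := by
      intro d; split_ifs <;> simp
    simp_rw [this]
    rw [← Finset.sum_mul, sum_moebius_dvd_eq_ite_coprime hl0]
    push_cast
    rw [jacobiSym.mul_left, jacobiSym.pow_left]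
    split_ifs with h
    · rw [jacobiSym.sq_one (by simpa [Int.gcd_natCast_natCast] using h)]; push_cast; ring
    · have : jacobiSym (l : ℤ) m = 0 := by
        rw [jacobiSym.eq_zero_iff_not_coprime]; simpa [Int.gcd_natCast_natCast] using h
      rw [this]; simp
  rw [Finset.sum_congr rfl hJ, Finset.sum_comm]
  have hB : ∀ d ∈ l.divisors, |∑ m ∈ (Finset.Icc 1 X).filter Odd, (if d ∣ m then
      (ArithmeticFunction.moebius d : ℝ) * jacobiSym (k : ℤ) m else 0)|
      ≤ 2 * (√k * (1 + Real.log k)) := by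
    intro d hd
    have hdl := Nat.dvd_of_mem_divisors hd
    have hdo : Odd d := Odd.of_dvd_nat hlo hdl
    have hdN : d ≠ 0 := hdo.pos.ne'
    rw [sum_filter_odd_dvd_Icc _ hdo]
    have h1 : ∀ m ∈ (Finset.Icc 1 (X / d)).filter Odd,
        (ArithmeticFunction.moebius d : ℝ) * (jacobiSym (k : ℤ) (d * m) : ℝ)
        = (ArithmeticFunction.moebius d * jacobiSym (k : ℤ) d : ℝ) * jacobiSym (k : ℤ) m := by
      intro m hm
      rw [jacobiSym.mul_right' _ hdN (by simp at hm; omega)]; push_cast; ring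
    rw [Finset.sum_congr rfl h1, ← Finset.mul_sum, abs_mul, abs_mul]
    have a1 : |(ArithmeticFunction.moebius d : ℝ)| ≤ 1 := by
      exact_mod_cast ArithmeticFunction.abs_moebius_le_one
    have a2 : |(jacobiSym (k : ℤ) d : ℝ)| ≤ 1 := by
      rcases jacobiSym.trichotomy (k : ℤ) d with h | h | h <;> simp [h]
    calc _ ≤ 1 * 1 * (2 * (√k * (1 + Real.log k))) := by
          gcongr; exact abs_sum_odd_jacobiSym_le_of_squarefree hk hko hk1 _
      _ = _ := by ring
  refine (Finset.abs_sum_le_sum_abs _ _).trans ((Finset.sum_le_sum hB).trans ?_)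
  rw [Finset.sum_const, nsmul_eq_mul]
  have hcard : (l.divisors.card : ℝ) ≤ l := by exact_mod_cast Nat.card_divisors_le_self l
  have hk0 : (0 : ℝ) < k := by exact_mod_cast hko.pos
  have hl1 : (1 : ℝ) ≤ l := by exact_mod_cast hlo.pos
  have hs : √((l ^ 2 * k : ℕ) : ℝ) = l * √k := by
    push_cast
    rw [Real.sqrt_mul (by positivity), Real.sqrt_sq (by positivity)]
  have hlog : Real.log k ≤ Real.log ((l ^ 2 * k : ℕ) : ℝ) := by
    apply Real.log_le_log hk0; push_cast; exact le_mul_of_one_le_left hk0.le (one_le_pow₀ hl1)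
  have hlog0 : 0 ≤ Real.log (k : ℝ) := Real.log_nonneg (by exact_mod_cast hk1.le)
  rw [hs]
  calc _ ≤ (l : ℝ) * (2 * (√k * (1 + Real.log k))) := by gcongr
    _ ≤ (l : ℝ) * (2 * (√k * (1 + Real.log ((l ^ 2 * k : ℕ) : ℝ)))) := by gcongr
    _ = _ := by ring

end JacobiSums

/-! ### The Selberg sieve with probabilistic removal

For each prime `p` of a finite set `P`, multiples of `p` are removed with probability `w p`. -/

section RandomSelberg

open Finset

/-- The function `h = g / (1 - g)` attached to the density `g p = w p / p`. -/
noncomputable def selbergH (w : ℕ → ℝ) (p : ℕ) : ℝ := w p / (p - w p)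

/-- Sets of primes whose product is at most the level `D`. -/
noncomputable def levelSets (P : Finset ℕ) (D : ℝ) : Finset (Finset ℕ) :=
  P.powerset.filter fun U => ((∏ p ∈ U, p : ℕ) : ℝ) ≤ D

/-- The main-term denominator of Selberg's sieve. -/
noncomputable def selbergG (P : Finset ℕ) (w : ℕ → ℝ) (D : ℝ) : ℝ :=
  ∑ U ∈ levelSets P D, ∏ p ∈ U, selbergH w p

/-- Local factor at `p` of the pair `U, V` when `p` is kept. -/
noncomputable def keptFactor (w : ℕ → ℝ) (U V : Finset ℕ) (p : ℕ) : ℝ :=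
  (if p ∈ U then selbergH w p else 1) * (if p ∈ V then selbergH w p else 1)

/-- Local factor at `p` of the pair `U, V` when `p` is removed. -/
noncomputable def removedFactor (U V : Finset ℕ) (p : ℕ) : ℝ :=
  (if p ∈ U then -1 else 1) * (if p ∈ V then -1 else 1)

/-- The upper bound sieve weights. -/
noncomputable def selbergTheta (P : Finset ℕ) (w : ℕ → ℝ) (D : ℝ) (R : Finset ℕ) : ℝ :=
  (selbergG P w D)⁻¹ ^ 2 * ∑ U ∈ levelSets P D, ∑ V ∈ levelSets P D,
    (∏ p ∈ R, w p * (removedFactor U V p - keptFactor w U V p)) * ∏ p ∈ P \ R, keptFactor w U V p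

variable {P : Finset ℕ} {w : ℕ → ℝ} {D : ℝ}

/-- The sum over `R` is the expansion of a product over `p`. Taking `c p` to be the indicator of `p
∣ m` gives the majorant, and `c p = 1 / p` gives its mean. -/
theorem sum_selbergTheta_mul_prod (c : ℕ → ℝ) :
    ∑ R ∈ P.powerset, selbergTheta P w D R * ∏ p ∈ R, c p
      = (selbergG P w D)⁻¹ ^ 2 * ∑ U ∈ levelSets P D, ∑ V ∈ levelSets P D,
        ∏ p ∈ P, (w p * (removedFactor U V p - keptFactor w U V p) * c p + keptFactor w U V p) := by
  simp_rw [selbergTheta, mul_assoc, ← mul_sum, prod_add, sum_mul]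
  congr 1
  rw [sum_comm]
  refine sum_congr rfl fun U _ => ?_
  rw [sum_comm]
  refine sum_congr rfl fun V _ => ?_
  refine sum_congr rfl fun R _ => ?_
  simp_rw [← mul_assoc]
  rw [prod_mul_distrib (f := fun p => w p * (removedFactor U V p - keptFactor w U V p))]
  ring

theorem subset_of_mem_levelSets {U : Finset ℕ} (hU : U ∈ levelSets P D) : U ⊆ P :=
  mem_powerset.mp (mem_filter.mp hU).1

theorem prod_ite_mem_of_subset {U : Finset ℕ} (hU : U ⊆ P) (c : ℕ → ℝ) :
    ∏ p ∈ P, (if p ∈ U then c p else 1) = ∏ p ∈ U, c p := by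
  rw [prod_ite_mem, inter_eq_right.mpr hU]

theorem one_le_selbergG (hP : ∀ p ∈ P, p.Prime) (hw0 : ∀ p ∈ P, 0 ≤ w p)
    (hw1 : ∀ p ∈ P, w p ≤ 1) (hD : 1 ≤ D) : 1 ≤ selbergG P w D := by
  have h0 : ∅ ∈ levelSets P D := by simp [levelSets, hD]
  have := single_le_sum (f := fun U => ∏ p ∈ U, selbergH w p) (s := levelSets P D) (fun U hU =>
    prod_nonneg fun p hp => ?_) h0
  · rw [selbergG]; simp only [prod_empty] at this; exact this
  · have hpP := subset_of_mem_levelSets hU hp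
    have : (2 : ℝ) ≤ p := by exact_mod_cast (hP p hpP).two_le
    exact div_nonneg (hw0 p hpP) (by linarith [hw1 p hpP])

/-- The sieve weights majorise the probability that `m` is kept. -/
theorem prod_le_sum_selbergTheta (hw0 : ∀ p ∈ P, 0 ≤ w p)
    (hw1 : ∀ p ∈ P, w p ≤ 1) (hG : selbergG P w D ≠ 0) (m : ℕ) :
    ∏ p ∈ P, (if p ∣ m then 1 - w p else 1)
      ≤ ∑ R ∈ P.powerset, selbergTheta P w D R * ∏ p ∈ R, (if p ∣ m then 1 else 0) := by
  -- Here `S` is the random set of primes chosen for removal, with probability `∏ w` over `S` times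
  -- `∏ (1 - w)` off `S`. For fixed `S`, the weight is the square of the normalised sum of `E S U`.
  set E : Finset ℕ → Finset ℕ → ℝ := fun S U =>
    ∏ p ∈ P, (if p ∈ U then (if p ∈ S ∧ p ∣ m then -1 else selbergH w p) else 1) with hE
  have hfac : ∀ U V : Finset ℕ, ∏ p ∈ P, (w p * (removedFactor U V p - keptFactor w U V p)
      * (if p ∣ m then 1 else 0) + keptFactor w U V p)
      = ∑ S ∈ P.powerset, ((∏ p ∈ S, w p) * ∏ p ∈ P \ S, (1 - w p)) * (E S U * E S V) := by
    intro U V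
    have h1 : ∀ p, (w p * (removedFactor U V p - keptFactor w U V p)
      * (if p ∣ m then 1 else 0) + keptFactor w U V p)
      = w p * (if p ∣ m then removedFactor U V p else keptFactor w U V p)
        + (1 - w p) * keptFactor w U V p := by
      intro p; split_ifs <;> ring
    simp_rw [h1]
    rw [prod_add]
    refine sum_congr rfl fun S hS => ?_
    have hSP := mem_powerset.mp hS
    have e1 : E S U * E S V = (∏ p ∈ P \ S,
        (if p ∈ U then (if p ∈ S ∧ p ∣ m then -1 else selbergH w p) else 1)
          * (if p ∈ V then (if p ∈ S ∧ p ∣ m then -1 else selbergH w p) else 1))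
        * ∏ p ∈ S, (if p ∈ U then (if p ∈ S ∧ p ∣ m then -1 else selbergH w p) else 1)
          * (if p ∈ V then (if p ∈ S ∧ p ∣ m then -1 else selbergH w p) else 1) := by
      rw [prod_sdiff hSP, prod_mul_distrib]
    rw [e1, prod_mul_distrib (f := w), prod_mul_distrib (f := fun p => 1 - w p)]
    have h2 : ∀ p ∈ S, (if p ∣ m then removedFactor U V p else keptFactor w U V p)
        = (if p ∈ U then (if p ∈ S ∧ p ∣ m then -1 else selbergH w p) else 1)
          * (if p ∈ V then (if p ∈ S ∧ p ∣ m then -1 else selbergH w p) else 1) := by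
      intro p hp
      simp only [hp, true_and, removedFactor, keptFactor]
      split_ifs <;> rfl
    have h3 : ∀ p ∈ P \ S, keptFactor w U V p
        = (if p ∈ U then (if p ∈ S ∧ p ∣ m then -1 else selbergH w p) else 1)
          * (if p ∈ V then (if p ∈ S ∧ p ∣ m then -1 else selbergH w p) else 1) := by
      intro p hp
      simp only [(mem_sdiff.mp hp).2, false_and, if_false, keptFactor]
    rw [prod_congr rfl h2, prod_congr rfl h3]
    ring
  rw [sum_selbergTheta_mul_prod]
  simp_rw [hfac]
  have hsq : (selbergG P w D)⁻¹ ^ 2 * ∑ U ∈ levelSets P D, ∑ V ∈ levelSets P D,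
      ∑ S ∈ P.powerset, ((∏ p ∈ S, w p) * ∏ p ∈ P \ S, (1 - w p)) * (E S U * E S V)
      = ∑ S ∈ P.powerset, ((∏ p ∈ S, w p) * ∏ p ∈ P \ S, (1 - w p))
        * ((selbergG P w D)⁻¹ * ∑ U ∈ levelSets P D, E S U) ^ 2 := by
    have : ∀ S, ((selbergG P w D)⁻¹ * ∑ U ∈ levelSets P D, E S U) ^ 2
      = (selbergG P w D)⁻¹ ^ 2 * ∑ U ∈ levelSets P D, ∑ V ∈ levelSets P D, E S U * E S V := by
      intro S; rw [mul_pow, sq (∑ U ∈ levelSets P D, E S U), sum_mul_sum]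
    simp_rw [this, mul_left_comm _ ((selbergG P w D)⁻¹ ^ 2), ← mul_sum]
    congr 1
    simp_rw [mul_sum]
    rw [sum_comm (s := P.powerset)]
    refine sum_congr rfl fun U _ => ?_
    rw [sum_comm]
  rw [hsq]
  have hwt : ∀ S ∈ P.powerset, 0 ≤ (∏ p ∈ S, w p) * ∏ p ∈ P \ S, (1 - w p) := by
    intro S hS
    refine mul_nonneg (prod_nonneg fun p hp => hw0 p (mem_powerset.mp hS hp))
      (prod_nonneg fun p hp => ?_)
    linarith [hw1 p (mem_sdiff.mp hp).1]
  have hlhs : ∏ p ∈ P, (if p ∣ m then 1 - w p else 1)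
      = ∑ S ∈ P.powerset, (∏ p ∈ S, w p * (if p ∣ m then 0 else 1)) * ∏ p ∈ P \ S, (1 - w p) := by
    rw [← prod_add]
    refine prod_congr rfl fun p _ => ?_
    split_ifs <;> ring
  rw [hlhs]
  refine sum_le_sum fun S hS => ?_
  -- If no chosen prime divides `m`, the normalised sum is `G⁻¹ G = 1`. Otherwise `m` is removed and
  -- a square is at least `0`.
  by_cases hSm : ∀ p ∈ S, ¬ p ∣ m
  · have h1 : ∀ U ∈ levelSets P D, E S U = ∏ p ∈ U, selbergH w p := by
      intro U hU
      rw [← prod_ite_mem_of_subset (subset_of_mem_levelSets hU)]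
      refine prod_congr rfl fun p _ => ?_
      rw [if_neg (fun h : p ∈ S ∧ p ∣ m => hSm p h.1 h.2)]
    rw [sum_congr rfl h1, ← selbergG, inv_mul_cancel₀ hG, one_pow, mul_one]
    refine le_of_eq ?_
    congr 1
    refine prod_congr rfl fun p hp => ?_
    rw [if_neg (hSm p hp), mul_one]
  · push Not at hSm
    obtain ⟨p, hp, hpm⟩ := hSm
    rw [prod_eq_zero hp (by simp [hpm]), zero_mul]
    exact mul_nonneg (hwt S hS) (sq_nonneg _)

/-- The total density of the sieve weights. -/
theorem sum_selbergTheta_div (hP : ∀ p ∈ P, p.Prime) (hw1 : ∀ p ∈ P, w p ≤ 1)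
    (hG : selbergG P w D ≠ 0) :
    ∑ R ∈ P.powerset, selbergTheta P w D R * ∏ p ∈ R, (p : ℝ)⁻¹ = (selbergG P w D)⁻¹ := by
  rw [sum_selbergTheta_mul_prod]
  have hp0 : ∀ p ∈ P, (p : ℝ) ≠ 0 ∧ (p : ℝ) - w p ≠ 0 := by
    intro p hp
    have : (2 : ℝ) ≤ p := by exact_mod_cast (hP p hp).two_le
    exact ⟨by linarith, by linarith [hw1 p hp]⟩
  -- Orthogonality: locally the variable is `-1` with probability `g = w p / p` and `h = g / (1 -
  -- g)` otherwise, so its mean is `0` and its second moment is `h`. Only the terms `V = U` survive.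
  have key : ∀ U ∈ levelSets P D, ∑ V ∈ levelSets P D,
      ∏ p ∈ P, (w p * (removedFactor U V p - keptFactor w U V p) * (p : ℝ)⁻¹ + keptFactor w U V p)
      = ∏ p ∈ U, selbergH w p := by
    intro U hU
    have hUP := subset_of_mem_levelSets hU
    rw [sum_eq_single_of_mem U hU]
    · rw [← prod_ite_mem_of_subset hUP]
      refine prod_congr rfl fun p hp => ?_
      obtain ⟨h1, h2⟩ := hp0 p hp
      simp only [removedFactor, keptFactor, selbergH]
      split_ifs
      · field_simp; ring
      · ring
    · intro V hV hVU
      have hVP := subset_of_mem_levelSets hV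
      obtain ⟨p, hp⟩ : ∃ p, ¬ (p ∈ U ↔ p ∈ V) := by
        by_contra h; push Not at h; exact hVU (ext fun p => (h p).symm)
      have hpP : p ∈ P := by
        by_contra h
        exact hp ⟨fun h' => absurd (hUP h') h, fun h' => absurd (hVP h') h⟩
      obtain ⟨h1, h2⟩ := hp0 p hpP
      refine prod_eq_zero hpP ?_
      simp only [removedFactor, keptFactor, selbergH]
      by_cases hpU : p ∈ U <;> by_cases hpV : p ∈ V
      · exact absurd ⟨fun _ => hpV, fun _ => hpU⟩ hp
      · simp only [hpU, hpV, if_true, if_false]; field_simp; ring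
      · simp only [hpU, hpV, if_true, if_false]; field_simp; ring
      · exact absurd ⟨fun h => absurd h hpU, fun h => absurd h hpV⟩ hp
  rw [sum_congr rfl key, ← selbergG]
  field_simp

theorem card_levelSets_le (hP : ∀ p ∈ P, p.Prime) (hD : 0 ≤ D) : ((levelSets P D).card : ℝ) ≤ D := by
  have h : (levelSets P D).card ≤ (Icc 1 ⌊D⌋₊).card := by
    refine card_le_card_of_injOn (fun U => ∏ p ∈ U, p) ?_ ?_
    · intro U hU
      have hU' := mem_filter.mp (mem_coe.mp hU)
      simp only [coe_Icc, Set.mem_Icc]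
      refine ⟨prod_pos fun p hp => (hP p (subset_of_mem_levelSets hU hp)).pos, Nat.le_floor hU'.2⟩
    · intro U hU V hV h
      have h' := congrArg Nat.primeFactors h
      simp only at h'
      rwa [Nat.primeFactors_prod fun p hp => hP p (subset_of_mem_levelSets hU hp),
        Nat.primeFactors_prod fun p hp => hP p (subset_of_mem_levelSets hV hp)] at h'
  rw [Nat.card_Icc, Nat.add_sub_cancel] at h
  calc ((levelSets P D).card : ℝ) ≤ (⌊D⌋₊ : ℝ) := by exact_mod_cast h
    _ ≤ D := Nat.floor_le hD

/-- As `p ≥ 3` gives `h ≤ 1 / 2`, each local factor is at most `2` for every one of `U`, `V`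
containing `p`. A pair therefore contributes at most `2 ^ |U| · 2 ^ |V| ≤ D²`, and there are at most
`D²` pairs. -/
theorem sum_abs_selbergTheta_le (hP : ∀ p ∈ P, p.Prime) (hP3 : ∀ p ∈ P, 3 ≤ p)
    (hw0 : ∀ p ∈ P, 0 ≤ w p) (hw1 : ∀ p ∈ P, w p ≤ 1) (hD : 1 ≤ D) :
    ∑ R ∈ P.powerset, |selbergTheta P w D R| ≤ D ^ 4 := by
  have hG := one_le_selbergG hP hw0 hw1 hD
  have hG1 : (selbergG P w D)⁻¹ ^ 2 ≤ 1 := pow_le_one₀ (by positivity) (inv_le_one_of_one_le₀ hG)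
  have h1 : ∀ R ∈ P.powerset, |selbergTheta P w D R| ≤ ∑ U ∈ levelSets P D, ∑ V ∈ levelSets P D,
      (∏ p ∈ R, |w p * (removedFactor U V p - keptFactor w U V p)|)
        * ∏ p ∈ P \ R, |keptFactor w U V p| := by
    intro R _
    rw [selbergTheta, abs_mul, abs_of_nonneg (sq_nonneg _)]
    refine (mul_le_of_le_one_left (abs_nonneg _) hG1).trans ?_
    refine (abs_sum_le_sum_abs _ _).trans (sum_le_sum fun U _ => ?_)
    refine (abs_sum_le_sum_abs _ _).trans (sum_le_sum fun V _ => ?_)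
    rw [abs_mul, abs_prod, abs_prod]
  refine (sum_le_sum h1).trans ?_
  rw [sum_comm]
  simp_rw [sum_comm (s := P.powerset), ← prod_add]
  have hpow : ∀ U ∈ levelSets P D, ∏ p ∈ P, (if p ∈ U then (2 : ℝ) else 1) ≤ D := by
    intro U hU
    rw [prod_ite_mem_of_subset (subset_of_mem_levelSets hU)]
    refine le_trans ?_ (mem_filter.mp hU).2
    push_cast
    refine prod_le_prod (fun _ _ => by norm_num) fun p hp => ?_
    exact_mod_cast (hP p (subset_of_mem_levelSets hU hp)).two_le
  have h2 : ∀ U ∈ levelSets P D, ∀ V ∈ levelSets P D,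
      ∏ p ∈ P, (|w p * (removedFactor U V p - keptFactor w U V p)| + |keptFactor w U V p|)
        ≤ D * D := by
    intro U hU V hV
    calc _ ≤ ∏ p ∈ P, ((if p ∈ U then (2 : ℝ) else 1) * (if p ∈ V then (2 : ℝ) else 1)) := by
          refine prod_le_prod (fun p _ => by positivity) fun p hp => ?_
          have h3 : (3 : ℝ) ≤ p := by exact_mod_cast hP3 p hp
          have hw0' := hw0 p hp
          have hw1' := hw1 p hp
          have hh0 : 0 ≤ selbergH w p := div_nonneg hw0' (by linarith)
          have hh1 : selbergH w p ≤ 1 / 2 := by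
            rw [selbergH, div_le_div_iff₀ (by linarith) two_pos]; linarith
          have hbd : ∀ x k : ℝ, |x| ≤ k → |w p * x| ≤ k := by
            intro x k hx
            rw [abs_mul, abs_of_nonneg hw0']
            nlinarith [abs_nonneg x]
          simp only [removedFactor, keptFactor]
          split_ifs
          · have := hbd ((-1) * (-1) - selbergH w p * selbergH w p) 1
              (by rw [abs_le]; constructor <;> nlinarith)
            rw [abs_of_nonneg (by positivity : 0 ≤ selbergH w p * selbergH w p)]
            nlinarith
          · have := hbd ((-1) * 1 - selbergH w p * 1) (3 / 2)
              (by rw [abs_le]; constructor <;> linarith)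
            rw [abs_of_nonneg (by positivity : 0 ≤ selbergH w p * 1), mul_one (selbergH w p)] at *
            exact (add_le_add this hh1).trans (by norm_num)
          · have := hbd (1 * (-1) - 1 * selbergH w p) (3 / 2)
              (by rw [abs_le]; constructor <;> linarith)
            rw [abs_of_nonneg (by positivity : 0 ≤ 1 * selbergH w p), one_mul (selbergH w p)] at *
            exact (add_le_add this hh1).trans (by norm_num)
          · norm_num
      _ = (∏ p ∈ P, (if p ∈ U then (2 : ℝ) else 1)) * ∏ p ∈ P, (if p ∈ V then (2 : ℝ) else 1) :=
          prod_mul_distrib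
      _ ≤ D * D := by
          refine mul_le_mul (hpow U hU) (hpow V hV) ?_ (by linarith)
          exact prod_nonneg fun p _ => by split_ifs <;> norm_num
  have hc := card_levelSets_le hP (by linarith : 0 ≤ D)
  calc _ ≤ ∑ U ∈ levelSets P D, ∑ V ∈ levelSets P D, D * D :=
        sum_le_sum fun U hU => sum_le_sum fun V hV => h2 U hU V hV
    _ = ((levelSets P D).card : ℝ) * ((levelSets P D).card * (D * D)) := by
        simp [sum_const, nsmul_eq_mul]
    _ ≤ D * (D * (D * D)) := by gcongr
    _ = D ^ 4 := by ring

end RandomSelberg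

/-! ### Elementary prime sums and a lower bound for the Selberg denominator -/

section PrimeSums

open Finset

/-- Double counting: the sum of `⌊n / p⌋ log p` is the sum over `m ≤ n` of the logarithm of the
radical of `m`, at most `n log n`. Replacing `n / p` by its floor costs a factor `2`. -/
theorem sum_primes_log_div_le {n : ℕ} (hn : 1 ≤ n) :
    ∑ p ∈ (Icc 1 n).filter Nat.Prime, Real.log p / p ≤ 2 * Real.log n := by
  have hn0 : (0 : ℝ) < n := by exact_mod_cast hn
  have h1 : ∑ p ∈ (Icc 1 n).filter Nat.Prime, ((n / p : ℕ) : ℝ) * Real.log p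
      ≤ n * Real.log n := by
    calc _ = ∑ p ∈ (Icc 1 n).filter Nat.Prime, ∑ m ∈ Ioc 0 n,
          (if p ∣ m then Real.log p else 0) := by
          refine sum_congr rfl fun p _ => ?_
          rw [← sum_filter, sum_const, nsmul_eq_mul, Nat.Ioc_filter_dvd_card_eq_div]
      _ = ∑ m ∈ Ioc 0 n, ∑ p ∈ (Icc 1 n).filter Nat.Prime,
          (if p ∣ m then Real.log p else 0) := sum_comm
      _ ≤ ∑ m ∈ Ioc 0 n, Real.log n := by
          refine sum_le_sum fun m hm => ?_
          rw [mem_Ioc] at hm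
          have hset : ((Icc 1 n).filter Nat.Prime).filter (· ∣ m) = m.primeFactors := by
            ext p
            simp only [mem_filter, mem_Icc, Nat.mem_primeFactors]
            constructor
            · rintro ⟨⟨_, h2⟩, h3⟩; exact ⟨h2, h3, by omega⟩
            · rintro ⟨h2, h3, _⟩
              exact ⟨⟨⟨h2.one_le, (Nat.le_of_dvd hm.1 h3).trans hm.2⟩, h2⟩, h3⟩
          rw [← sum_filter, hset, ← Real.log_prod fun p hp => by
            exact_mod_cast (Nat.prime_of_mem_primeFactors hp).ne_zero]
          have hpos : 0 < ∏ p ∈ m.primeFactors, p :=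
            prod_pos fun p hp => (Nat.prime_of_mem_primeFactors hp).pos
          rw [← Nat.cast_prod]
          apply Real.log_le_log (by exact_mod_cast hpos)
          exact_mod_cast (Nat.le_of_dvd hm.1 (Nat.prod_primeFactors_dvd m)).trans hm.2
      _ = n * Real.log n := by simp
  have h2 : ∀ p ∈ (Icc 1 n).filter Nat.Prime, (n : ℝ) * (Real.log p / p)
      ≤ 2 * (((n / p : ℕ) : ℝ) * Real.log p) := by
    intro p hp
    simp only [mem_filter, mem_Icc] at hp
    have hp0 : (0 : ℝ) < p := by exact_mod_cast hp.2.pos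
    have hlog : 0 ≤ Real.log (p : ℝ) := Real.log_natCast_nonneg p
    have hdiv : (n : ℝ) / p ≤ 2 * ((n / p : ℕ) : ℝ) := by
      rw [div_le_iff₀ hp0]
      have e1 := Nat.div_add_mod n p
      have e2 := Nat.mod_lt n hp.2.pos
      have e3 : 1 ≤ n / p := Nat.div_pos hp.1.2 hp.2.pos
      have : n ≤ 2 * (n / p) * p := by nlinarith
      exact_mod_cast this
    calc (n : ℝ) * (Real.log p / p) = n / p * Real.log p := by ring
      _ ≤ 2 * ((n / p : ℕ) : ℝ) * Real.log p := by gcongr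
      _ = _ := by ring
  have h3 := sum_le_sum h2
  rw [← mul_sum, ← mul_sum] at h3
  have h4 : (n : ℝ) * ∑ p ∈ (Icc 1 n).filter Nat.Prime, Real.log p / p
      ≤ n * (2 * Real.log n) := by linarith
  exact le_of_mul_le_mul_left h4 hn0

/-- The Euler product sums `1 / m` over all integers whose prime factors are at most `n`, hence
dominates the harmonic sum. -/
theorem log_succ_le_prod_primes (n : ℕ) :
    Real.log (n + 1) ≤ ∏ p ∈ (Icc 1 n).filter Nat.Prime, (1 - (p : ℝ)⁻¹)⁻¹ := by
  let f : ℕ →* ℝ :=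
    { toFun := fun m => (m : ℝ)⁻¹
      map_one' := by simp
      map_mul' := fun a b => by push_cast; rw [mul_inv] }
  have hf : ∀ {p : ℕ}, p.Prime → ‖f p‖ < 1 := by
    intro p hp
    change ‖(p : ℝ)⁻¹‖ < 1
    rw [norm_inv, Real.norm_natCast]
    exact inv_lt_one_of_one_lt₀ (by exact_mod_cast hp.one_lt)
  have h := (EulerProduct.summable_and_hasSum_smoothNumbers_prod_primesBelow_geometric (f := f)
    hf (n + 1)).2
  have hset : (n + 1).primesBelow = (Icc 1 n).filter Nat.Prime := by
    ext p
    simp only [Nat.mem_primesBelow, mem_filter, mem_Icc]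
    constructor
    · rintro ⟨h1, h2⟩; exact ⟨⟨h2.one_le, by omega⟩, h2⟩
    · rintro ⟨h1, h2⟩; exact ⟨by omega, h2⟩
  rw [hset] at h
  have hmem : ∀ m ∈ Icc 1 n, m ∈ (n + 1).smoothNumbers := by
    intro m hm
    rw [mem_Icc] at hm
    exact Nat.mem_smoothNumbers_of_lt hm.1 (by omega)
  have h1 : ∑ m ∈ Icc 1 n, (m : ℝ)⁻¹ ≤ ∏ p ∈ (Icc 1 n).filter Nat.Prime, (1 - f p)⁻¹ := by
    have := sum_le_hasSum ((Icc 1 n).attach.map ⟨fun m => (⟨m.1, hmem m.1 m.2⟩ :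
      (n + 1).smoothNumbers), fun a b hab => by
        have h' := congrArg Subtype.val hab
        exact Subtype.ext h'⟩) (fun m _ => ?_) h
    · rw [sum_map] at this
      refine le_trans (le_of_eq ?_) this
      rw [← sum_attach]
      rfl
    · exact inv_nonneg.mpr (Nat.cast_nonneg _)
  have h2 := log_add_one_le_harmonic n
  rw [harmonic_eq_sum_Icc] at h2
  push_cast at h2
  exact h2.trans h1

theorem sum_Icc_two_inv_mul_le (n : ℕ) :
    ∑ k ∈ Icc 2 n, (1 / ((k : ℝ) - 1) - 1 / k) ≤ 1 := by
  have : ∀ n : ℕ, 1 ≤ n → ∑ k ∈ Icc 2 n, (1 / ((k : ℝ) - 1) - 1 / k) = 1 - 1 / n := by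
    intro n hn
    induction n, hn using Nat.le_induction with
    | base => simp
    | succ n hn ih =>
      rw [← Finset.insert_Icc_right_eq_Icc_add_one (by omega), sum_insert (by simp), ih]
      push_cast; ring
  rcases Nat.eq_zero_or_pos n with rfl | hn
  · simp
  · rw [this n hn]
    have : (0 : ℝ) ≤ 1 / n := by positivity
    linarith

/-- Lower bound in Mertens' second theorem. -/
theorem log_log_le_sum_primes_inv {n : ℕ} (hn : 1 ≤ n) :
    Real.log (Real.log (n + 1)) - 1 ≤ ∑ p ∈ (Icc 1 n).filter Nat.Prime, 1 / (p : ℝ) := by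
  have hl : 0 < Real.log ((n : ℝ) + 1) := Real.log_pos (by
    have : (1 : ℝ) ≤ n := by exact_mod_cast hn
    linarith)
  have hp : ∀ p ∈ (Icc 1 n).filter Nat.Prime, (2 : ℝ) ≤ p := by
    intro p hp; exact_mod_cast (mem_filter.mp hp).2.two_le
  have hne : ∀ p ∈ (Icc 1 n).filter Nat.Prime, 0 < (1 - (p : ℝ)⁻¹)⁻¹ := by
    intro p h
    have := hp p h
    have h2 : (p : ℝ)⁻¹ ≤ 2⁻¹ := inv_anti₀ two_pos this
    apply inv_pos.mpr; linarith
  have h1 := Real.log_le_log hl (log_succ_le_prod_primes n)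
  rw [Real.log_prod fun p h => (hne p h).ne'] at h1
  have h2 : ∀ p ∈ (Icc 1 n).filter Nat.Prime, Real.log (1 - (p : ℝ)⁻¹)⁻¹
      ≤ 1 / p + (1 / ((p : ℝ) - 1) - 1 / p) := by
    intro p h
    have h2 := hp p h
    refine (Real.log_le_sub_one_of_pos (hne p h)).trans (le_of_eq ?_)
    have a1 : (p : ℝ) ≠ 0 := by linarith
    have a2 : (p : ℝ) - 1 ≠ 0 := by linarith
    have a3 : (1 - (p : ℝ)⁻¹)⁻¹ = p / (p - 1) := by
      rw [show 1 - (p : ℝ)⁻¹ = (p - 1) / p by field_simp, inv_div]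
    rw [a3]; field_simp; ring
  have h3 := sum_le_sum h2
  rw [sum_add_distrib] at h3
  have h4 : ∑ p ∈ (Icc 1 n).filter Nat.Prime, (1 / ((p : ℝ) - 1) - 1 / p) ≤ 1 := by
    refine le_trans (sum_le_sum_of_subset_of_nonneg ?_ ?_) (sum_Icc_two_inv_mul_le n)
    · intro p h
      simp only [mem_filter, mem_Icc] at h ⊢
      exact ⟨h.2.two_le, h.1.2⟩
    · intro k hk _
      have : (2 : ℝ) ≤ k := by exact_mod_cast (mem_Icc.mp hk).1
      rw [sub_nonneg]
      apply one_div_le_one_div_of_le <;> linarith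
  linarith

variable {P : Finset ℕ} {w : ℕ → ℝ}

theorem exp_sum_le_prod_one_add_selbergH (hP : ∀ p ∈ P, p.Prime) (hw1 : ∀ p ∈ P, w p ≤ 1) :
    Real.exp (∑ p ∈ P, w p / p) ≤ ∏ p ∈ P, (1 + selbergH w p) := by
  rw [Real.exp_sum]
  refine prod_le_prod (fun _ _ => (Real.exp_pos _).le) fun p hp => ?_
  have h2 : (2 : ℝ) ≤ p := by exact_mod_cast (hP p hp).two_le
  have h3 := hw1 p hp
  have h4 : (0 : ℝ) < p - w p := by linarith
  have h5 : 1 + selbergH w p = (1 - w p / p)⁻¹ := by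
    rw [selbergH, show 1 - w p / p = (p - w p) / p by field_simp, inv_div]
    field_simp; ring
  have h6 : 0 < 1 - w p / p := by
    rw [sub_pos, div_lt_one (by linarith)]; linarith
  rw [h5, ← inv_inv (Real.exp _), ← Real.exp_neg]
  apply inv_anti₀ h6
  have := Real.add_one_le_exp (-(w p / p))
  linarith

/-- Rankin's trick: truncating at level `z ^ 7` costs at most a factor `2`. -/
theorem prod_one_add_selbergH_le {z : ℝ} (hz : 2 ≤ z) (hP : ∀ p ∈ P, p.Prime)
    (hP3 : ∀ p ∈ P, 3 ≤ p) (hPz : ∀ p ∈ P, (p : ℝ) ≤ z) (hw0 : ∀ p ∈ P, 0 ≤ w p)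
    (hw1 : ∀ p ∈ P, w p ≤ 1) :
    ∏ p ∈ P, (1 + selbergH w p) ≤ 2 * selbergG P w (z ^ 7) := by
  have hz0 : 0 < z := by linarith
  have hlz : 0 < Real.log z := Real.log_pos (by linarith)
  -- With this exponent `z ^ κ = e`, so a set of primes with product above `z ^ 7` gains a factor at
  -- least `exp 7`.
  set κ : ℝ := 1 / Real.log z with hκ
  have hκ0 : 0 < κ := by positivity
  have hh0 : ∀ p ∈ P, 0 ≤ selbergH w p := by
    intro p hp
    have : (3 : ℝ) ≤ p := by exact_mod_cast hP3 p hp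
    exact div_nonneg (hw0 p hp) (by linarith [hw1 p hp])
  have hzk : z ^ κ = Real.exp 1 := by
    rw [Real.rpow_def_of_pos hz0, hκ]; congr 1; field_simp
  have hfull : ∏ p ∈ P, (1 + selbergH w p) = ∑ U ∈ P.powerset, ∏ p ∈ U, selbergH w p :=
    prod_one_add P
  -- Weighting by `p ^ κ` costs at most `exp 6`: each prime contributes `3 log p / (p log z)` to the
  -- exponent, and the sum of `log p / p` is at most `2 log z`. The tail is thus at most `exp (6 -
  -- 7) ≤ 1 / 2` of the full product.
  have hratio : ∏ p ∈ P, (1 + selbergH w p * (p : ℝ) ^ κ)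
      ≤ Real.exp 6 * ∏ p ∈ P, (1 + selbergH w p) := by
    have h1 : ∀ p ∈ P, 1 + selbergH w p * (p : ℝ) ^ κ
        ≤ (1 + selbergH w p) * Real.exp (3 / Real.log z * (Real.log p / p)) := by
      intro p hp
      have h3 : (3 : ℝ) ≤ p := by exact_mod_cast hP3 p hp
      have hp0 : (0 : ℝ) < p := by linarith
      have hh := hh0 p hp
      have hlp : 0 ≤ Real.log p := Real.log_nonneg (by linarith)
      set t := Real.log p * κ with ht
      have ht0 : 0 ≤ t := by positivity
      have ht1 : t ≤ 1 := by
        rw [ht, hκ, mul_one_div, div_le_one hlz]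
        exact Real.log_le_log hp0 (hPz p hp)
      have hpk : (p : ℝ) ^ κ ≤ 1 + 2 * t := by
        rw [Real.rpow_def_of_pos hp0]
        have := Real.abs_exp_sub_one_le (x := t) (by rw [abs_of_nonneg ht0]; exact ht1)
        rw [abs_of_nonneg ht0] at this
        linarith [le_abs_self (Real.exp t - 1)]
      have hhp : selbergH w p ≤ 3 / 2 / p := by
        rw [selbergH, div_le_div_iff₀ (by linarith [hw1 p hp]) hp0]
        nlinarith [hw1 p hp, hw0 p hp]
      have h4 := Real.add_one_le_exp (3 / Real.log z * (Real.log p / p))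
      have h5 : selbergH w p * (2 * t) ≤ 3 / Real.log z * (Real.log p / p) := by
        calc _ ≤ 3 / 2 / p * (2 * t) := by gcongr
          _ = _ := by rw [ht, hκ]; field_simp
      have h6 : 0 ≤ 3 / Real.log z * (Real.log p / p) := by positivity
      calc 1 + selbergH w p * (p : ℝ) ^ κ ≤ 1 + selbergH w p * (1 + 2 * t) := by gcongr
        _ ≤ (1 + selbergH w p) * (3 / Real.log z * (Real.log p / p) + 1) := by nlinarith
        _ ≤ _ := by gcongr
    have h0 : ∀ p ∈ P, 0 ≤ 1 + selbergH w p * (p : ℝ) ^ κ := by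
      intro p hp
      have := hh0 p hp
      positivity
    refine (prod_le_prod h0 h1).trans ?_
    rw [prod_mul_distrib, mul_comm, ← Real.exp_sum, ← mul_sum]
    have hfl : 1 ≤ ⌊z⌋₊ := Nat.le_floor (by push_cast; linarith)
    have h7 : ∑ p ∈ P, Real.log p / p ≤ 2 * Real.log z := by
      calc _ ≤ ∑ p ∈ (Icc 1 ⌊z⌋₊).filter Nat.Prime, Real.log p / p := by
            refine sum_le_sum_of_subset_of_nonneg ?_ ?_
            · intro p hp
              simp only [mem_filter, mem_Icc]
              exact ⟨⟨(hP p hp).one_le, Nat.le_floor (hPz p hp)⟩, hP p hp⟩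
            · intro p _ _
              exact div_nonneg (Real.log_natCast_nonneg p) (Nat.cast_nonneg _)
        _ ≤ 2 * Real.log ⌊z⌋₊ := sum_primes_log_div_le hfl
        _ ≤ 2 * Real.log z := by
            gcongr
            exact Nat.floor_le hz0.le
    have h8 : 0 ≤ ∏ p ∈ P, (1 + selbergH w p) :=
      prod_nonneg fun p hp => by linarith [hh0 p hp]
    gcongr
    calc _ ≤ 3 / Real.log z * (2 * Real.log z) := by gcongr
      _ = 6 := by field_simp; norm_num
  have hsplit : ∑ U ∈ P.powerset, ∏ p ∈ U, selbergH w p ≤ selbergG P w (z ^ 7)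
      + Real.exp (-7) * ∏ p ∈ P, (1 + selbergH w p * (p : ℝ) ^ κ) := by
    rw [← sum_filter_add_sum_filter_not P.powerset (fun U => ((∏ p ∈ U, p : ℕ) : ℝ) ≤ z ^ 7)]
    refine add_le_add (le_of_eq rfl) ?_
    rw [prod_one_add, mul_sum, sum_filter]
    refine sum_le_sum fun U hU => ?_
    have hUP := mem_powerset.mp hU
    have hU0 : 0 ≤ ∏ p ∈ U, selbergH w p := prod_nonneg fun p hp => hh0 p (hUP hp)
    rw [prod_mul_distrib, Real.finsetProd_rpow _ _ (fun _ _ => Nat.cast_nonneg _)]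
    split_ifs with h
    · have : 0 ≤ (∏ p ∈ U, (p : ℝ)) ^ κ := by positivity
      positivity
    · push Not at h
      have h2 : Real.exp 7 ≤ (∏ p ∈ U, (p : ℝ)) ^ κ := by
        calc Real.exp 7 = (z ^ 7) ^ κ := by
              rw [← Real.rpow_natCast, ← Real.rpow_mul hz0.le, mul_comm, Real.rpow_mul hz0.le, hzk,
                ← Real.exp_mul]
              norm_num
          _ ≤ _ := by
              push_cast at h
              gcongr
      calc _ = Real.exp (-7) * ((∏ p ∈ U, selbergH w p) * Real.exp 7) := by
            rw [mul_left_comm, ← Real.exp_add]; norm_num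
        _ ≤ _ := by gcongr
  have h8 : 0 ≤ ∏ p ∈ P, (1 + selbergH w p) :=
    prod_nonneg fun p hp => by linarith [hh0 p hp]
  have hfin : Real.exp (-7) * ∏ p ∈ P, (1 + selbergH w p * (p : ℝ) ^ κ)
      ≤ 1 / 2 * ∏ p ∈ P, (1 + selbergH w p) := by
    calc _ ≤ Real.exp (-7) * (Real.exp 6 * ∏ p ∈ P, (1 + selbergH w p)) := by gcongr
      _ = Real.exp (-1) * ∏ p ∈ P, (1 + selbergH w p) := by
          rw [← mul_assoc, ← Real.exp_add]; norm_num
      _ ≤ _ := by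
          gcongr
          rw [Real.exp_neg, one_div]
          apply inv_anti₀ two_pos
          have := Real.add_one_le_exp 1
          linarith
  rw [hfull] at hfin ⊢
  linarith

/-- The odd primes up to `z`. -/
noncomputable def oddPrimes (z : ℝ) : Finset ℕ := (Icc 3 ⌊z⌋₊).filter Nat.Prime

theorem prime_of_mem_oddPrimes {z : ℝ} {p : ℕ} (hp : p ∈ oddPrimes z) : p.Prime :=
  (mem_filter.mp hp).2

theorem three_le_of_mem_oddPrimes {z : ℝ} {p : ℕ} (hp : p ∈ oddPrimes z) : 3 ≤ p :=
  (mem_Icc.mp (mem_filter.mp hp).1).1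

theorem selbergG_oddPrimes_ge {f : ℕ → ℝ} {α K z : ℝ} (hz : 2 ≤ z) (hf0 : ∀ n, 0 ≤ f n)
    (hf1 : ∀ p : ℕ, p.Prime → f p ≤ 1)
    (hK : |∑ p ∈ (Icc 1 ⌊z⌋₊).filter Nat.Prime, f p / (p : ℝ)
      - α * Real.log (Real.log z)| ≤ K) :
    Real.exp (-(3 / 2) - K) / 2 * Real.log z ^ (1 - α)
      ≤ selbergG (oddPrimes z) (fun p => 1 - f p) (z ^ 7) := by
  have hz0 : 0 < z := by linarith
  have hlz : 0 < Real.log z := Real.log_pos (by linarith)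
  have hfl : 2 ≤ ⌊z⌋₊ := Nat.le_floor (by exact_mod_cast hz)
  have h1 := prod_one_add_selbergH_le (P := oddPrimes z) (w := fun p => 1 - f p) hz
    (fun p => prime_of_mem_oddPrimes) (fun p => three_le_of_mem_oddPrimes)
    (fun p hp => by
      refine le_trans ?_ (Nat.floor_le hz0.le)
      exact_mod_cast (mem_Icc.mp (mem_filter.mp hp).1).2)
    (fun p hp => by linarith [hf1 p (prime_of_mem_oddPrimes hp)])
    (fun p _ => by linarith [hf0 p])
  have h2 := exp_sum_le_prod_one_add_selbergH (P := oddPrimes z) (w := fun p => 1 - f p)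
    (fun p => prime_of_mem_oddPrimes) (fun p _ => by linarith [hf0 p])
  have hins : (Icc 1 ⌊z⌋₊).filter Nat.Prime = insert 2 (oddPrimes z) := by
    ext p
    simp only [oddPrimes, mem_filter, mem_Icc, mem_insert]
    constructor
    · rintro ⟨⟨_, h3⟩, h4⟩
      have := h4.two_le
      by_cases hp2 : p = 2
      · exact Or.inl hp2
      · exact Or.inr ⟨⟨by omega, h3⟩, h4⟩
    · rintro (rfl | ⟨⟨h3, h4⟩, h5⟩)
      · exact ⟨⟨by omega, hfl⟩, Nat.prime_two⟩
      · exact ⟨⟨by omega, h4⟩, h5⟩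
  have hni : 2 ∉ oddPrimes z := fun h => by
    have := three_le_of_mem_oddPrimes h; omega
  have h3 := log_log_le_sum_primes_inv (n := ⌊z⌋₊) (by omega)
  rw [hins, sum_insert hni] at h3
  have h4 : Real.log (Real.log z) ≤ Real.log (Real.log (⌊z⌋₊ + 1)) := by
    apply Real.log_le_log hlz
    exact Real.log_le_log hz0 (Nat.lt_floor_add_one z).le
  have h5 := (abs_le.mp hK).2
  rw [hins, sum_insert hni] at h5
  have h6 : ∑ p ∈ oddPrimes z, (1 - f p) / (p : ℝ)
      = ∑ p ∈ oddPrimes z, 1 / (p : ℝ) - ∑ p ∈ oddPrimes z, f p / (p : ℝ) := by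
    rw [← sum_sub_distrib]; exact sum_congr rfl fun p _ => sub_div _ _ _
  -- The loss `3 / 2` is `1` from Mertens and `1 / 2` from the omitted prime `2`.
  have h7 : (1 - α) * Real.log (Real.log z) + (-(3 / 2) - K)
      ≤ ∑ p ∈ oddPrimes z, (1 - f p) / (p : ℝ) := by
    rw [h6]
    have := hf0 2
    push_cast at h3 h5
    linarith
  have h8 := Real.exp_le_exp.mpr h7
  rw [Real.exp_add, mul_comm (1 - α), ← Real.rpow_def_of_pos hlz] at h8
  linarith [h8.trans (h2.trans h1)]

end PrimeSums

/-! ### Pairs of integers whose product is a square -/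

section SquarePairs

open Finset

theorem eq_of_squarefree_of_isSquare_mul {a b : ℕ} (ha : Squarefree a) (hb : Squarefree b)
    (hab : IsSquare (a * b)) : a = b := by
  have key : ∀ x y : ℕ, Squarefree x → IsSquare (x * y) → x.primeFactors ⊆ y.primeFactors ∨ y = 0 := by
    rintro x y hx ⟨t, ht⟩
    by_cases hy : y = 0
    · exact Or.inr hy
    refine Or.inl fun p hp => ?_
    have hpp := Nat.prime_of_mem_primeFactors hp
    have hpx := Nat.dvd_of_mem_primeFactors hp
    rw [Nat.mem_primeFactors]
    refine ⟨hpp, ?_, hy⟩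
    by_contra hpy
    have h1 : p ∣ t := by
      have : p ∣ t * t := ht ▸ hpx.mul_right y
      exact (hpp.dvd_mul.mp this).elim id id
    have h2 : p * p ∣ x * y := ht ▸ mul_dvd_mul h1 h1
    have h3 : (p * p).Coprime y :=
      Nat.Coprime.mul_left ((Nat.Prime.coprime_iff_not_dvd hpp).mpr hpy)
        ((Nat.Prime.coprime_iff_not_dvd hpp).mpr hpy)
    exact hpp.not_isUnit (hx p (h3.dvd_of_dvd_mul_right h2))
  have h1 := (key a b ha hab).resolve_right hb.ne_zero
  have h2 := (key b a hb (by rwa [mul_comm])).resolve_right ha.ne_zero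
  rw [← Nat.prod_primeFactors_of_squarefree ha, ← Nat.prod_primeFactors_of_squarefree hb,
    h1.antisymm h2]

theorem sum_inv_sq_le_of_gt {A : Finset ℕ} {X : ℝ} (hX : 0 < X) (hA : ∀ r ∈ A, X < r) :
    ∑ r ∈ A, ((r : ℝ) ^ 2)⁻¹ ≤ 2 / X := by
  have hsub : A ⊆ Ioo ⌊X⌋₊ (A.sup id + 1) := by
    intro r hr
    rw [mem_Ioo]
    exact ⟨(Nat.floor_lt hX.le).mpr (hA r hr), Nat.lt_succ_of_le (le_sup (f := id) hr)⟩
  calc _ ≤ ∑ r ∈ Ioo ⌊X⌋₊ (A.sup id + 1), ((r : ℝ) ^ 2)⁻¹ :=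
        sum_le_sum_of_subset_of_nonneg hsub fun _ _ _ => by positivity
    _ ≤ 2 / (⌊X⌋₊ + 1) := sum_Ioo_inv_sq_le _ _
    _ ≤ 2 / X := by
        gcongr
        exact (Nat.lt_floor_add_one X).le

/-- The product `i j` is a square only if `i` and `j` share a squarefree core `d`. Writing `i = r²
d` with `r² > W / d`, the reciprocals over one core sum to at most `2 / √(d W)`; squaring and
summing over `d` gives a harmonic sum. -/
theorem sum_square_pairs_le {W : ℝ} (hW : 0 < W) (n : ℕ) :
    ∑ i ∈ Ioc ⌊W⌋₊ n, ∑ j ∈ Ioc ⌊W⌋₊ n, (if IsSquare (i * j) then 1 / ((i : ℝ) * j) else 0)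
      ≤ 4 / W * (1 + Real.log n) := by
  choose core rt hrt hcore using Nat.sq_mul_squarefree
  set I := Ioc ⌊W⌋₊ n with hI
  have hIpos : ∀ i ∈ I, W < i ∧ 0 < i ∧ i ≤ n := by
    intro i hi
    rw [hI, mem_Ioc] at hi
    exact ⟨(Nat.floor_lt hW.le).mp hi.1, by omega, hi.2⟩
  have hrt0 : ∀ i ∈ I, 0 < rt i := by
    intro i hi
    rcases Nat.eq_zero_or_pos (rt i) with h | h
    · have := hrt i; rw [h] at this; have := (hIpos i hi).2.1; omega
    · exact h
  have hmaps : ∀ i ∈ I, core i ∈ Icc 1 n := by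
    intro i hi
    rw [mem_Icc]
    refine ⟨Nat.pos_of_ne_zero (hcore i).ne_zero, ?_⟩
    have h1 : core i ∣ i := ⟨rt i ^ 2, by rw [mul_comm]; exact (hrt i).symm⟩
    exact (Nat.le_of_dvd (hIpos i hi).2.1 h1).trans (hIpos i hi).2.2
  have hcoreeq : ∀ i ∈ I, ∀ j ∈ I, IsSquare (i * j) → core i = core j := by
    intro i hi j hj ⟨s, hs⟩
    apply eq_of_squarefree_of_isSquare_mul (hcore i) (hcore j)
    have h1 : (rt i * rt j) ^ 2 * (core i * core j) = s ^ 2 := by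
      rw [sq s, ← hs]
      nth_rw 3 [← hrt i]
      nth_rw 3 [← hrt j]
      ring
    have h2 : rt i * rt j ∣ s := by
      rw [← Nat.pow_dvd_pow_iff two_ne_zero, ← h1]; exact Dvd.intro _ rfl
    obtain ⟨u, rfl⟩ := h2
    have h3 : 0 < (rt i * rt j) ^ 2 := pow_pos (Nat.mul_pos (hrt0 i hi) (hrt0 j hj)) 2
    refine ⟨u, Nat.eq_of_mul_eq_mul_left h3 ?_⟩
    rw [h1]; ring
  have hfib : ∀ d ∈ Icc 1 n, ∑ i ∈ I.filter (fun i => core i = d), 1 / (i : ℝ)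
      ≤ 2 / √(d * W) := by
    intro d hd
    have hd0 : (0 : ℝ) < d := by exact_mod_cast (mem_Icc.mp hd).1
    have hinj : Set.InjOn rt (I.filter (fun i => core i = d)) := by
      intro i hi j hj hij
      have hi' := (mem_filter.mp (mem_coe.mp hi)).2
      have hj' := (mem_filter.mp (mem_coe.mp hj)).2
      rw [← hrt i, ← hrt j, hij, hi', hj']
    have hX : 0 < √(W / d) := Real.sqrt_pos.mpr (by positivity)
    have h1 : ∀ i ∈ I.filter (fun i => core i = d), (rt i : ℝ) ^ 2 * d = i := by
      intro i hi
      have := hrt i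
      rw [(mem_filter.mp hi).2] at this
      exact_mod_cast this
    have h2 := sum_inv_sq_le_of_gt (A := (I.filter (fun i => core i = d)).image rt) hX (by
      intro r hr
      obtain ⟨i, hi, rfl⟩ := mem_image.mp hr
      rw [Real.sqrt_lt' (by exact_mod_cast hrt0 i (mem_filter.mp hi).1), div_lt_iff₀ hd0, h1 i hi]
      exact (hIpos i (mem_filter.mp hi).1).1)
    rw [sum_image hinj] at h2
    calc _ = (d : ℝ)⁻¹ * ∑ i ∈ I.filter (fun i => core i = d), ((rt i : ℝ) ^ 2)⁻¹ := by
          rw [mul_sum]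
          refine sum_congr rfl fun i hi => ?_
          rw [← h1 i hi, one_div, mul_inv, mul_comm]
      _ ≤ (d : ℝ)⁻¹ * (2 / √(W / d)) := by gcongr
      _ = 2 / √(d * W) := by
          rw [show (d : ℝ) * W = d ^ 2 * (W / d) by field_simp, Real.sqrt_mul (by positivity),
            Real.sqrt_sq hd0.le]
          field_simp
  calc _ ≤ ∑ i ∈ I, ∑ j ∈ I, (if core i = core j then 1 / (i : ℝ) * (1 / j) else 0) := by
        refine sum_le_sum fun i hi => sum_le_sum fun j hj => ?_
        split_ifs with h1 h2 h2
        · rw [one_div_mul_one_div]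
        · exact absurd (hcoreeq i hi j hj h1) h2
        · positivity
        · exact le_rfl
    _ = ∑ d ∈ Icc 1 n, (∑ i ∈ I.filter (fun i => core i = d), 1 / (i : ℝ)) ^ 2 := by
        rw [← sum_fiberwise_of_maps_to hmaps]
        refine sum_congr rfl fun d _ => ?_
        rw [sq, sum_mul_sum]
        refine sum_congr rfl fun i hi => ?_
        rw [sum_filter]
        refine sum_congr rfl fun j _ => ?_
        rw [(mem_filter.mp hi).2]
        simp only [eq_comm]
    _ ≤ ∑ d ∈ Icc 1 n, 4 / W * (d : ℝ)⁻¹ := by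
        refine sum_le_sum fun d hd => ?_
        have hd0 : (0 : ℝ) < d := by exact_mod_cast (mem_Icc.mp hd).1
        calc _ ≤ (2 / √(d * W)) ^ 2 := by
              gcongr
              exact hfib d hd
          _ = _ := by
              rw [div_pow, Real.sq_sqrt (by positivity)]; field_simp; norm_num
    _ ≤ _ := by
        rw [← mul_sum]
        have h := harmonic_le_one_add_log n
        rw [harmonic_eq_sum_Icc] at h
        push_cast at h
        gcongr

end SquarePairs

/-! ### Sums against the sieve weights -/

section SieveSums

open Finset

variable {P : Finset ℕ} {w : ℕ → ℝ} {D : ℝ}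

/-- The sieve majorant. -/
noncomputable def selbergMajorant (P : Finset ℕ) (w : ℕ → ℝ) (D : ℝ) (m : ℕ) : ℝ :=
  ∑ R ∈ P.powerset, selbergTheta P w D R * ∏ p ∈ R, (if p ∣ m then 1 else 0)

theorem prod_ite_dvd {R : Finset ℕ} (hR : ∀ p ∈ R, p.Prime) (m : ℕ) :
    ∏ p ∈ R, (if p ∣ m then (1 : ℝ) else 0) = if (∏ p ∈ R, p) ∣ m then 1 else 0 := by
  split_ifs with h
  · refine prod_eq_one fun p hp => if_pos ((dvd_prod_of_mem _ hp).trans h)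
  · by_contra hne
    apply h
    refine prod_primes_dvd m (fun p hp => (hR p hp).prime) fun p hp => ?_
    by_contra hpm
    exact hne (prod_eq_zero hp (if_neg hpm))

theorem sum_selbergMajorant_mul (hP : ∀ p ∈ P, p.Prime) (hP3 : ∀ p ∈ P, 3 ≤ p) (ψ : ℕ → ℝ)
    (X : ℕ) :
    ∑ m ∈ (Icc 1 X).filter Odd, selbergMajorant P w D m * ψ m
      = ∑ R ∈ P.powerset, selbergTheta P w D R *
        ∑ m ∈ (Icc 1 (X / ∏ p ∈ R, p)).filter Odd, ψ ((∏ p ∈ R, p) * m) := by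
  simp_rw [selbergMajorant, sum_mul]
  rw [sum_comm]
  refine sum_congr rfl fun R hR => ?_
  have hRP := mem_powerset.mp hR
  have hodd : Odd (∏ p ∈ R, p) := by
    apply prod_induction _ Odd (fun _ _ => Odd.mul) odd_one
    intro p hp
    exact (hP p (hRP hp)).odd_of_ne_two (by have := hP3 p (hRP hp); omega)
  rw [← sum_filter_odd_dvd_Icc _ hodd, mul_sum]
  refine sum_congr rfl fun m _ => ?_
  rw [prod_ite_dvd fun p hp => hP p (hRP hp)]
  split_ifs <;> ring

theorem abs_card_odd_sub_le (x : ℝ) (hx : 0 ≤ x) :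
    |(((Icc 1 ⌊x⌋₊).filter Odd).card : ℝ) - x / 2| ≤ 1 := by
  have h := sum_filter_odd_Icc (fun _ => 1) ⌊x⌋₊
  simp only [sum_const, card_range, nsmul_eq_mul, mul_one] at h
  rw [h]
  have h1 := Nat.floor_le hx
  have h2 := Nat.lt_floor_add_one x
  have h3 : 2 * ((⌊x⌋₊ + 3) / 4 + (⌊x⌋₊ + 1) / 4) ≤ ⌊x⌋₊ + 1 := by omega
  have h4 : ⌊x⌋₊ ≤ 2 * ((⌊x⌋₊ + 3) / 4 + (⌊x⌋₊ + 1) / 4) := by omega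
  have h3' : (2 : ℝ) * (((⌊x⌋₊ + 3) / 4 : ℕ) + ((⌊x⌋₊ + 1) / 4 : ℕ)) ≤ ⌊x⌋₊ + 1 := by
    exact_mod_cast h3
  have h4' : (⌊x⌋₊ : ℝ) ≤ 2 * (((⌊x⌋₊ + 3) / 4 : ℕ) + ((⌊x⌋₊ + 1) / 4 : ℕ)) := by
    exact_mod_cast h4
  rw [abs_le]
  constructor <;> linarith

/-- Each `R`, with product `q`, counts odd multiples of `q` up to `M`, that is `M / (2 q)` up to
error `1`. The main terms add to `M / (2G)` and the errors to at most the total mass of the weights.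
-/
theorem sum_selbergMajorant_le (hP : ∀ p ∈ P, p.Prime) (hP3 : ∀ p ∈ P, 3 ≤ p)
    (hw0 : ∀ p ∈ P, 0 ≤ w p) (hw1 : ∀ p ∈ P, w p ≤ 1) (hD : 1 ≤ D) {M : ℝ} (hM : 0 ≤ M) :
    ∑ m ∈ (Icc 1 ⌊M⌋₊).filter Odd, selbergMajorant P w D m
      ≤ M / (2 * selbergG P w D) + D ^ 4 := by
  have hG := one_le_selbergG hP hw0 hw1 hD
  have h1 := sum_selbergMajorant_mul (w := w) (D := D) hP hP3 (fun _ => 1) ⌊M⌋₊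
  simp only [mul_one, sum_const, nsmul_eq_mul] at h1
  rw [h1]
  have h2 : ∀ R ∈ P.powerset, selbergTheta P w D R *
      (((Icc 1 (⌊M⌋₊ / ∏ p ∈ R, p)).filter Odd).card : ℝ)
      ≤ M / 2 * (selbergTheta P w D R * ∏ p ∈ R, (p : ℝ)⁻¹) + |selbergTheta P w D R| := by
    intro R _
    rw [← Nat.floor_div_natCast]
    have h3 := abs_card_odd_sub_le (M / (∏ p ∈ R, p : ℕ)) (by positivity)
    have h4 : M / 2 * (selbergTheta P w D R * ∏ p ∈ R, (p : ℝ)⁻¹)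
        = selbergTheta P w D R * (M / (∏ p ∈ R, p : ℕ) / 2) := by
      rw [prod_inv_distrib]; push_cast; ring
    rw [h4, ← sub_le_iff_le_add', ← mul_sub]
    refine (le_abs_self _).trans ?_
    rw [abs_mul]
    exact mul_le_of_le_one_right (abs_nonneg _) h3
  refine (sum_le_sum h2).trans ?_
  rw [sum_add_distrib, ← mul_sum, sum_selbergTheta_div hP hw1 (by linarith)]
  refine add_le_add (le_of_eq ?_) (sum_abs_selbergTheta_le hP hP3 hw0 hw1 hD)
  field_simp

theorem abs_jacobiSym_le_one (a : ℤ) (b : ℕ) : |(jacobiSym a b : ℝ)| ≤ 1 := by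
  rcases jacobiSym.trichotomy a b with h | h | h <;> simp [h]

theorem abs_sum_selbergMajorant_mul_jacobiSym_le (hP : ∀ p ∈ P, p.Prime) (hP3 : ∀ p ∈ P, 3 ≤ p)
    (hw0 : ∀ p ∈ P, 0 ≤ w p) (hw1 : ∀ p ∈ P, w p ≤ 1) (hD : 1 ≤ D) {κ : ℕ} (hodd : Odd κ)
    (hsq : ¬ IsSquare κ) (X : ℕ) :
    |∑ m ∈ (Icc 1 X).filter Odd, selbergMajorant P w D m * (jacobiSym (κ : ℤ) m : ℝ)|
      ≤ D ^ 4 * (2 * (√κ * (1 + Real.log κ))) := by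
  rw [sum_selbergMajorant_mul hP hP3 (fun m => (jacobiSym (κ : ℤ) m : ℝ))]
  have hB : 0 ≤ 2 * (√κ * (1 + Real.log κ)) := by
    have := Real.log_natCast_nonneg κ
    positivity
  refine (abs_sum_le_sum_abs _ _).trans (le_trans (sum_le_sum
    (g := fun R => |selbergTheta P w D R| * (2 * (√κ * (1 + Real.log κ)))) fun R hR => ?_) ?_)
  · rw [abs_mul]
    gcongr
    have hq : ∏ p ∈ R, p ≠ 0 :=
      prod_ne_zero_iff.mpr fun p hp => (hP p (mem_powerset.mp hR hp)).ne_zero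
    have h1 : ∀ m ∈ (Icc 1 (X / ∏ p ∈ R, p)).filter Odd,
        (jacobiSym (κ : ℤ) ((∏ p ∈ R, p) * m) : ℝ)
        = jacobiSym (κ : ℤ) (∏ p ∈ R, p) * jacobiSym (κ : ℤ) m := by
      intro m hm
      rw [jacobiSym.mul_right' _ hq (by simp at hm; omega)]; push_cast; rfl
    rw [sum_congr rfl h1, ← mul_sum, abs_mul]
    exact (mul_le_of_le_one_left (abs_nonneg _) (abs_jacobiSym_le_one _ _)).trans
      (abs_sum_odd_jacobiSym_le hodd hsq _)
  · rw [← sum_mul]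
    gcongr
    exact sum_abs_selbergTheta_le hP hP3 hw0 hw1 hD

end SieveSums

/-! ### The bilinear bound -/

section Bilinear

open Finset

theorem sum_one_div_sqrt_le (n : ℕ) : ∑ i ∈ Icc 1 n, 1 / √(i : ℝ) ≤ 2 * √n := by
  induction n with
  | zero => simp
  | succ n ih =>
    rw [← Finset.insert_Icc_right_eq_Icc_add_one (by omega), sum_insert (by simp)]
    have h0 : 0 < √((n + 1 : ℕ) : ℝ) := Real.sqrt_pos.mpr (by positivity)
    have h1 : √(n : ℝ) ^ 2 = n := Real.sq_sqrt (by positivity)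
    have h2 : √((n + 1 : ℕ) : ℝ) ^ 2 = n + 1 := by
      rw [Real.sq_sqrt (by positivity)]; push_cast; ring
    have h3 : 1 / √((n + 1 : ℕ) : ℝ) ≤ 2 * (√((n + 1 : ℕ) : ℝ) - √(n : ℝ)) := by
      rw [div_le_iff₀ h0]
      nlinarith [sq_nonneg (√((n + 1 : ℕ) : ℝ) - √(n : ℝ))]
    linarith

variable {P : Finset ℕ} {w : ℕ → ℝ} {D : ℝ}

theorem selbergMajorant_nonneg (hP : ∀ p ∈ P, p.Prime) (hw0 : ∀ p ∈ P, 0 ≤ w p)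
    (hw1 : ∀ p ∈ P, w p ≤ 1) (hD : 1 ≤ D) (m : ℕ) : 0 ≤ selbergMajorant P w D m := by
  have hG := one_le_selbergG hP hw0 hw1 hD
  refine le_trans (prod_nonneg fun p hp => ?_) (prod_le_sum_selbergTheta hw0 hw1 (by linarith) m)
  split_ifs
  · linarith [hw1 p hp]
  · norm_num

/-- The second moment of character sums against the sieve majorant. -/
theorem sum_selbergMajorant_mul_normSq_le (hP : ∀ p ∈ P, p.Prime) (hP3 : ∀ p ∈ P, 3 ≤ p)
    (hw0 : ∀ p ∈ P, 0 ≤ w p) (hw1 : ∀ p ∈ P, w p ≤ 1) (hD : 1 ≤ D) {W : ℝ} (hW : 0 < W)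
    (n X : ℕ) (a : ℕ → ℂ) (ha : ∀ i, ‖a i‖ ≤ 1) (hae : ∀ i, Even i → a i = 0) :
    ∑ m ∈ (Icc 1 X).filter Odd, selbergMajorant P w D m *
        ‖∑ i ∈ Ioc ⌊W⌋₊ n, a i / (i : ℂ) * ((jacobiSym (i : ℤ) m : ℤ) : ℂ)‖ ^ 2
      ≤ (∑ m ∈ (Icc 1 X).filter Odd, selbergMajorant P w D m) * (4 / W * (1 + Real.log n))
        + D ^ 4 * (8 * (n * (1 + 2 * Real.log n))) := by
  set F := selbergMajorant P w D with hF
  set I := Ioc ⌊W⌋₊ n with hI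
  set J := (Icc 1 X).filter Odd with hJ
  set T := ∑ m ∈ J, F m with hT
  have hF0 : ∀ m, 0 ≤ F m := selbergMajorant_nonneg hP hw0 hw1 hD
  have hT0 : 0 ≤ T := sum_nonneg fun m _ => hF0 m
  have hIpos : ∀ i ∈ I, 1 ≤ i ∧ i ≤ n := by
    intro i hi; rw [hI, mem_Ioc] at hi; exact ⟨by omega, hi.2⟩
  have hlogn : 0 ≤ Real.log (n : ℝ) := Real.log_natCast_nonneg n
  set c : ℕ → ℂ := fun i => a i / (i : ℂ) with hc
  have hexp : ((∑ m ∈ J, F m * ‖∑ i ∈ I, c i * ((jacobiSym (i : ℤ) m : ℤ) : ℂ)‖ ^ 2 : ℝ) : ℂ)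
      = ∑ i ∈ I, ∑ j ∈ I, c i * (starRingEnd ℂ) (c j) *
        ((∑ m ∈ J, F m * (jacobiSym ((i * j : ℕ) : ℤ) m : ℝ) : ℝ) : ℂ) := by
    push_cast
    simp_rw [← Complex.mul_conj', map_sum, map_mul, sum_mul_sum, mul_sum, map_intCast]
    rw [sum_comm]
    refine sum_congr rfl fun i _ => ?_
    rw [sum_comm]
    refine sum_congr rfl fun j _ => sum_congr rfl fun m _ => ?_
    rw [jacobiSym.mul_left]
    push_cast
    ring
  -- Square products get the trivial bound `T`. For odd nonsquare products the factor `√(i j)` from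
  -- Pólya–Vinogradov against `1 / (i j)` leaves `1 / √(i j)`, which sums to at most `4 n`.
  have hterm : ∀ i ∈ I, ∀ j ∈ I, ‖c i * (starRingEnd ℂ) (c j) *
        ((∑ m ∈ J, F m * (jacobiSym ((i * j : ℕ) : ℤ) m : ℝ) : ℝ) : ℂ)‖
      ≤ T * (if IsSquare (i * j) then 1 / ((i : ℝ) * j) else 0)
        + D ^ 4 * (2 * (1 + 2 * Real.log n)) * (1 / √(i : ℝ) * (1 / √(j : ℝ))) := by
    intro i hi j hj
    have hi0 : (0 : ℝ) < i := by exact_mod_cast (hIpos i hi).1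
    have hj0 : (0 : ℝ) < j := by exact_mod_cast (hIpos j hj).1
    have hcn : ∀ k : ℕ, ‖c k‖ ≤ 1 / k := by
      intro k
      rw [hc]
      simp only
      rw [norm_div, Complex.norm_natCast]
      gcongr
      exact ha k
    have hsecond : 0 ≤ D ^ 4 * (2 * (1 + 2 * Real.log n)) * (1 / √(i : ℝ) * (1 / √(j : ℝ))) := by
      positivity
    have hfirst : 0 ≤ T * (if IsSquare (i * j) then 1 / ((i : ℝ) * j) else 0) := by
      apply mul_nonneg hT0
      split_ifs
      · positivity
      · exact le_rfl
    by_cases hodd : Odd (i * j)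
    · rw [norm_mul, norm_mul, RCLike.norm_conj, Complex.norm_real, Real.norm_eq_abs]
      have hcc : ‖c i‖ * ‖c j‖ ≤ 1 / ((i : ℝ) * j) := by
        rw [← one_div_mul_one_div]
        exact mul_le_mul (hcn i) (hcn j) (norm_nonneg _) (by positivity)
      by_cases hsq : IsSquare (i * j)
      · rw [if_pos hsq]
        have : |∑ m ∈ J, F m * (jacobiSym ((i * j : ℕ) : ℤ) m : ℝ)| ≤ T := by
          refine (abs_sum_le_sum_abs _ _).trans (sum_le_sum fun m _ => ?_)
          rw [abs_mul, abs_of_nonneg (hF0 m)]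
          exact mul_le_of_le_one_right (hF0 m) (abs_jacobiSym_le_one _ _)
        have h2 := mul_le_mul hcc this (abs_nonneg _) (by positivity)
        linarith
      · have h1 := abs_sum_selbergMajorant_mul_jacobiSym_le (w := w) hP hP3 hw0 hw1 hD hodd hsq X
        have hlog : Real.log ((i * j : ℕ) : ℝ) ≤ 2 * Real.log n := by
          push_cast
          rw [Real.log_mul hi0.ne' hj0.ne', two_mul]
          have := (hIpos i hi).2
          have := (hIpos j hj).2
          gcongr
        have h2 := mul_le_mul hcc h1 (abs_nonneg _) (by positivity)
        refine (h2.trans ?_).trans (le_add_of_nonneg_left hfirst)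
        calc _ ≤ 1 / ((i : ℝ) * j) * (D ^ 4 * (2 * (√((i * j : ℕ) : ℝ) * (1 + 2 * Real.log n)))) := by
              gcongr
          _ = _ := by
              push_cast
              rw [Real.sqrt_mul hi0.le]
              have e1 : √(i : ℝ) ≠ 0 := (Real.sqrt_pos.mpr hi0).ne'
              have e2 : √(j : ℝ) ≠ 0 := (Real.sqrt_pos.mpr hj0).ne'
              nth_rw 1 [← Real.mul_self_sqrt hi0.le]
              nth_rw 1 [← Real.mul_self_sqrt hj0.le]
              field_simp
    · have h0 : c i * (starRingEnd ℂ) (c j) = 0 := by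
        rw [Nat.not_odd_iff_even, Nat.even_mul] at hodd
        rcases hodd with h | h
        · simp [hc, hae i h]
        · simp [hc, hae j h]
      rw [h0, zero_mul, norm_zero]
      linarith
  have hnn : 0 ≤ ∑ m ∈ J, F m * ‖∑ i ∈ I, c i * ((jacobiSym (i : ℤ) m : ℤ) : ℂ)‖ ^ 2 :=
    sum_nonneg fun m _ => mul_nonneg (hF0 m) (sq_nonneg _)
  rw [← Real.norm_of_nonneg hnn, ← Complex.norm_real, hexp]
  refine (norm_sum_le _ _).trans ((sum_le_sum fun i hi => (norm_sum_le _ _).trans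
    (sum_le_sum fun j hj => hterm i hi j hj)).trans ?_)
  simp_rw [sum_add_distrib, ← mul_sum]
  have hsqrt : ∑ i ∈ I, 1 / √(i : ℝ) ≤ 2 * √n := by
    refine (sum_le_sum_of_subset_of_nonneg ?_ fun _ _ _ => by positivity).trans
      (sum_one_div_sqrt_le n)
    intro i hi
    exact mem_Icc.mpr (hIpos i hi)
  have hs0 : 0 ≤ ∑ i ∈ I, 1 / √(i : ℝ) := sum_nonneg fun _ _ => by positivity
  refine add_le_add (mul_le_mul_of_nonneg_left (sum_square_pairs_le hW n) hT0) ?_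
  rw [← sum_mul]
  calc _ ≤ D ^ 4 * (2 * (1 + 2 * Real.log n)) * ((2 * √n) * (2 * √n)) := by gcongr
    _ = D ^ 4 * (2 * (1 + 2 * Real.log n)) * (4 * (√n * √n)) := by ring
    _ = _ := by rw [Real.mul_self_sqrt (by positivity)]; ring

/-- A multiplicative function bounded on prime powers is at most the product of its values at the
primes of `P` dividing the argument. -/
theorem le_prod_of_isMultiplicative {f : ArithmeticFunction ℝ} (hf : f.IsMultiplicative)
    (hf0 : ∀ n, 0 ≤ f n) (hf1 : ∀ p : ℕ, p.Prime → f p ≤ 1)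
    (hfp : ∀ p m : ℕ, p.Prime → 2 ≤ m → f (p ^ m) ≤ f p) (P : Finset ℕ) {m : ℕ} (hm : m ≠ 0) :
    f m ≤ ∏ p ∈ P.filter Nat.Prime, (if p ∣ m then f p else 1) := by
  rw [ArithmeticFunction.IsMultiplicative.multiplicative_factorization f hf hm,
    Finsupp.prod, Nat.support_factorization]
  -- Each prime power value is at most `f p`; primes outside `P` are discarded using `f p ≤ 1`.
  calc _ ≤ ∏ p ∈ m.primeFactors, (if p ∈ P.filter Nat.Prime then f p else 1) := by
        refine prod_le_prod (fun _ _ => hf0 _) fun p hp => ?_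
        have hpp := Nat.prime_of_mem_primeFactors hp
        have h1 : f (p ^ m.factorization p) ≤ f p := by
          have hv : 1 ≤ m.factorization p :=
            hpp.factorization_pos_of_dvd hm (Nat.dvd_of_mem_primeFactors hp)
          rcases hv.eq_or_lt with h | h
          · rw [← h, pow_one]
          · exact hfp p _ hpp h
        split_ifs
        · exact h1
        · exact h1.trans (hf1 p hpp)
    _ = ∏ p ∈ P.filter Nat.Prime, (if p ∈ m.primeFactors then f p else 1) := by
        rw [prod_ite_mem, prod_ite_mem, inter_comm]
    _ = _ := by
        refine prod_congr rfl fun p hp => ?_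
        have hpp := (mem_filter.mp hp).2
        simp [hpp, hm]

/-- Cauchy–Schwarz with the sieve majorant. -/
theorem normSq_bilinear_le (hP : ∀ p ∈ P, p.Prime) (hP3 : ∀ p ∈ P, 3 ≤ p)
    (hD : 1 ≤ D) {f : ArithmeticFunction ℝ} (hf : f.IsMultiplicative)
    (hf0 : ∀ n, 0 ≤ f n) (hf1 : ∀ p : ℕ, p.Prime → f p ≤ 1)
    (hfp : ∀ p m : ℕ, p.Prime → 2 ≤ m → f (p ^ m) ≤ f p) {W : ℝ} (hW : 0 < W)
    (n X : ℕ) (a b : ℕ → ℂ) (ha : ∀ i, ‖a i‖ ≤ 1) (hb : ∀ i, ‖b i‖ ≤ 1)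
    (hae : ∀ i, Even i → a i = 0) (hbe : ∀ i, Even i → b i = 0) {T : ℝ}
    (hT : ∑ m ∈ (Icc 1 X).filter Odd, selbergMajorant P (fun p => 1 - f p) D m ≤ T) :
    ‖∑ i ∈ Ioc ⌊W⌋₊ n, ∑ m ∈ Icc 1 X, a i / (i : ℂ) * b m * ((f m : ℝ) : ℂ)
        * ((jacobiSym (i : ℤ) m : ℤ) : ℂ)‖ ^ 2
      ≤ T * (T * (4 / W * (1 + Real.log n)) + D ^ 4 * (8 * (n * (1 + 2 * Real.log n)))) := by
  set w : ℕ → ℝ := fun p => 1 - f p with hw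
  have hw0 : ∀ p ∈ P, 0 ≤ w p := fun p hp => by linarith [hf1 p (hP p hp)]
  have hw1 : ∀ p ∈ P, w p ≤ 1 := fun p _ => by linarith [hf0 p]
  set F := selbergMajorant P w D with hF
  set J := (Icc 1 X).filter Odd with hJ
  have hF0 : ∀ m, 0 ≤ F m := selbergMajorant_nonneg hP hw0 hw1 hD
  have hG := one_le_selbergG hP hw0 hw1 hD
  have hfF : ∀ m ∈ J, f m ≤ F m := by
    intro m hm
    have hm0 : m ≠ 0 := by
      have := (mem_Icc.mp (mem_filter.mp hm).1).1; omega
    have h1 := le_prod_of_isMultiplicative hf hf0 hf1 hfp P hm0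
    rw [filter_true_of_mem hP] at h1
    refine h1.trans (le_trans (le_of_eq ?_) (prod_le_sum_selbergTheta hw0 hw1 (by linarith) m))
    refine prod_congr rfl fun p _ => ?_
    simp [hw]
  set A : ℕ → ℂ := fun m => ∑ i ∈ Ioc ⌊W⌋₊ n, a i / (i : ℂ) * ((jacobiSym (i : ℤ) m : ℤ) : ℂ)
    with hA
  have hS : ‖∑ i ∈ Ioc ⌊W⌋₊ n, ∑ m ∈ Icc 1 X, a i / (i : ℂ) * b m * ((f m : ℝ) : ℂ)
        * ((jacobiSym (i : ℤ) m : ℤ) : ℂ)‖ ≤ ∑ m ∈ J, F m * ‖A m‖ := by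
    rw [sum_comm, hJ, sum_filter]
    refine (norm_sum_le _ _).trans (sum_le_sum fun m hm => ?_)
    have h1 : ∑ i ∈ Ioc ⌊W⌋₊ n, a i / (i : ℂ) * b m * ((f m : ℝ) : ℂ)
        * ((jacobiSym (i : ℤ) m : ℤ) : ℂ) = b m * ((f m : ℝ) : ℂ) * A m := by
      rw [hA, mul_sum]
      exact sum_congr rfl fun i _ => by ring
    rw [h1]
    split_ifs with hodd
    · rw [norm_mul, norm_mul, Complex.norm_real, Real.norm_of_nonneg (hf0 m)]
      gcongr
      calc ‖b m‖ * f m ≤ 1 * f m := mul_le_mul_of_nonneg_right (hb m) (hf0 m)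
        _ ≤ F m := by rw [one_mul]; exact hfF m (mem_filter.mpr ⟨hm, hodd⟩)
    · rw [hbe m (Nat.not_odd_iff_even.mp hodd)]; simp
  have hCS : (∑ m ∈ J, F m * ‖A m‖) ^ 2 ≤ (∑ m ∈ J, F m) * ∑ m ∈ J, F m * ‖A m‖ ^ 2 :=
    sum_sq_le_sum_mul_sum_of_sq_le_mul J (fun m _ => hF0 m)
      (fun m _ => mul_nonneg (hF0 m) (sq_nonneg _)) fun m _ => le_of_eq (by ring)
  have hsecond := sum_selbergMajorant_mul_normSq_le hP hP3 hw0 hw1 hD hW n X a ha hae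
  have hT0 : 0 ≤ ∑ m ∈ J, F m := sum_nonneg fun m _ => hF0 m
  have hlogn : 0 ≤ Real.log (n : ℝ) := Real.log_natCast_nonneg n
  calc _ ≤ (∑ m ∈ J, F m * ‖A m‖) ^ 2 := by gcongr
    _ ≤ _ := hCS
    _ ≤ T * (T * (4 / W * (1 + Real.log n)) + D ^ 4 * (8 * (n * (1 + 2 * Real.log n)))) := by
        refine mul_le_mul hT (hsecond.trans ?_) (sum_nonneg fun m _ =>
          mul_nonneg (hF0 m) (sq_nonneg _)) (hT0.trans hT)
        gcongr

/-- The trivial bound, needed only for bounded `M`, where the sieve has no room. -/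
theorem norm_bilinear_le_mul {f : ArithmeticFunction ℝ} (hf : f.IsMultiplicative)
    (hf0 : ∀ n, 0 ≤ f n) (hf1 : ∀ p : ℕ, p.Prime → f p ≤ 1)
    (hfp : ∀ p m : ℕ, p.Prime → 2 ≤ m → f (p ^ m) ≤ f p) (k n X : ℕ) (a b : ℕ → ℂ)
    (ha : ∀ i, ‖a i‖ ≤ 1) (hb : ∀ i, ‖b i‖ ≤ 1) :
    ‖∑ i ∈ Ioc k n, ∑ m ∈ Icc 1 X, a i / (i : ℂ) * b m * ((f m : ℝ) : ℂ)
        * ((jacobiSym (i : ℤ) m : ℤ) : ℂ)‖ ≤ n * X := by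
  calc _ ≤ ∑ i ∈ Ioc k n, ∑ m ∈ Icc 1 X, (1 : ℝ) := by
        refine (norm_sum_le _ _).trans (sum_le_sum fun i hi => (norm_sum_le _ _).trans
          (sum_le_sum fun m hm => ?_))
        have hi1 : (1 : ℝ) ≤ i := by
          rw [mem_Ioc] at hi; exact_mod_cast (by omega : 1 ≤ i)
        have hm0 : m ≠ 0 := by rw [mem_Icc] at hm; omega
        have hfm : f m ≤ 1 := by
          simpa using le_prod_of_isMultiplicative hf hf0 hf1 hfp ∅ hm0
        have h1 : ‖a i / (i : ℂ)‖ ≤ 1 := by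
          rw [norm_div, Complex.norm_natCast, div_le_one (by linarith)]
          exact (ha i).trans hi1
        have h2 : ‖((jacobiSym (i : ℤ) m : ℤ) : ℂ)‖ ≤ 1 := by
          rw [Complex.norm_intCast]; exact abs_jacobiSym_le_one _ _
        rw [norm_mul, norm_mul, norm_mul, Complex.norm_real, Real.norm_of_nonneg (hf0 m)]
        exact mul_le_one₀ (mul_le_one₀ (mul_le_one₀ h1 (norm_nonneg _) (hb m)) (hf0 m) hfm)
          (norm_nonneg _) h2
    _ = ((n - k : ℕ) : ℝ) * X := by simp
    _ ≤ n * X := by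
        gcongr
        exact Nat.sub_le n k

end Bilinear

/-! ### Choice of parameters and the final estimate -/

theorem rpow_le_one_add {x s : ℝ} (hx : 0 ≤ x) (hs0 : 0 ≤ s) (hs1 : s ≤ 1) : x ^ s ≤ 1 + x := by
  rcases le_total x 1 with h | h
  · linarith [Real.rpow_le_one hx h hs0]
  · have := Real.rpow_le_rpow_of_exponent_le h hs1
    rw [Real.rpow_one] at this
    linarith

theorem one_add_le_six_mul_sq {x : ℝ} (hx : 0.69 ≤ x) : 1 + x ≤ 6 * x ^ 2 := by
  nlinarith

theorem le_mul_add_of_sq_le {S A B s t : ℝ} (hA : 0 ≤ A) (hB : 0 ≤ B) (hs : 0 ≤ s) (ht : 0 ≤ t)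
    (h : S ^ 2 ≤ A * s ^ 2 + B * t ^ 2) : S ≤ (1 + (A + B)) * (s + t) := by
  refine le_of_sq_le_sq (h.trans ?_) (by positivity)
  have h1 : 0 ≤ A * (2 * s * t + t ^ 2) + B * (s ^ 2 + 2 * s * t) := by positivity
  have h2 : (A + B) * (s + t) ^ 2 ≤ (1 + (A + B)) ^ 2 * (s + t) ^ 2 := by
    gcongr
    nlinarith
  rw [mul_pow]
  linarith

theorem corollary1p2 (ε : ℝ) (hε : 0 < ε) (K : ℝ) :
    ∃ C : ℝ, ∀ (α : ℝ) (f : ArithmeticFunction ℝ) (M N W : ℝ) (a b : ℕ → ℂ),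
      0 < α → α < 1 →
      f.IsMultiplicative →
      (∀ n : ℕ, 0 ≤ f n) →
      (∀ p : ℕ, p.Prime → f p ≤ 1) →
      (∀ p m : ℕ, p.Prime → 2 ≤ m → f (p ^ m) ≤ f p) →
      (∀ X : ℝ, 2 ≤ X →
        |∑ p ∈ (Finset.Icc 1 ⌊X⌋₊).filter Nat.Prime, f p / (p : ℝ)
          - α * Real.log (Real.log X)| ≤ K) →
      2 ≤ W → W ≤ N → N ≤ M →
      (∀ n : ℕ, ‖a n‖ ≤ 1) → (∀ m : ℕ, ‖b m‖ ≤ 1) →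
      (∀ n : ℕ, Even n → a n = 0) → (∀ m : ℕ, Even m → b m = 0) →
      ‖∑ n ∈ Finset.Ioc ⌊W⌋₊ ⌊N⌋₊, ∑ m ∈ Finset.Icc 1 ⌊M⌋₊,
          a n / (n : ℂ) * b m * ((f m : ℝ) : ℂ) * ((jacobiSym (n : ℤ) m : ℤ) : ℂ)‖
        ≤ C * (M * Real.log N / (W ^ (1 / 2 : ℝ) * Real.log M ^ (1 - α))
            + M ^ (1 / 2 + ε) * N ^ (1 / 2 : ℝ) * Real.log N ^ (1 / 2 : ℝ)
              / Real.log M ^ ((1 - α) / 2)) := by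
  -- The sieve error will be `D ^ 4 = M ^ μ`. It must be at most `M ^ (2ε)` in the off-diagonal
  -- term, and at most `M ^ (1 / 2)` to be absorbed in the mass `M / L`.
  set μ : ℝ := min (2 * ε) (1 / 2) with hμ
  have hμ0 : 0 < μ := lt_min (by linarith) (by norm_num)
  have hμε : μ ≤ 2 * ε := min_le_left _ _
  have hμh : μ ≤ 1 / 2 := min_le_right _ _
  -- With `z = M ^ η` and level `D = z ^ 7`, the exponent of `D ^ 4` is `28 η = μ`.
  set η : ℝ := μ / 28 with hη
  have hη0 : 0 < η := by positivity
  have hη1 : η ≤ 1 := by rw [hη]; linarith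
  -- The threshold beyond which `z ≥ 2`.
  set M₀ : ℝ := 2 ^ (1 / η) with hM₀
  have hM₀1 : 1 ≤ M₀ := Real.one_le_rpow (by norm_num) (by positivity)
  -- The factor `η` replaces `η ^ (1 - α)`, which is at least `η`; this keeps the constant
  -- independent of `α`.
  set c : ℝ := Real.exp (-(3 / 2) - K) / 2 * η with hc
  have hc0 : 0 < c := by positivity
  set C₁ : ℝ := 1 / (2 * c) + 2 with hC₁
  have hC₁0 : 0 < C₁ := by positivity
  set C₂ : ℝ := 24 * C₁ ^ 2 + 32 * C₁ with hC₂
  have hC₂0 : 0 < C₂ := by positivity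
  -- The first summand serves `M < M₀` by the trivial bound, the second `M ≥ M₀` by the sieve.
  refine ⟨2 * M₀ ^ 2 * (1 + M₀) + (1 + C₂), ?_⟩
  intro α f M N W a b hα0 hα1 hf hf0 hf1 hfp hK hW hWN hNM ha hb hae hbe
  have hN : 2 ≤ N := hW.trans hWN
  have hM : 2 ≤ M := hN.trans hNM
  have hW0 : 0 < W := by linarith
  have hN0 : 0 < N := by linarith
  have hM0 : 0 < M := by linarith
  have hlog2 : 0.69 ≤ Real.log 2 := by linarith [Real.log_two_gt_d9]
  have hlN : 0.69 ≤ Real.log N := hlog2.trans (Real.log_le_log (by norm_num) hN)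
  have hlM : 0.69 ≤ Real.log M := hlog2.trans (Real.log_le_log (by norm_num) hM)
  have hlM0 : 0 < Real.log M := by linarith
  set L : ℝ := Real.log M ^ (1 - α) with hL
  have hL0 : 0 < L := Real.rpow_pos_of_pos hlM0 _
  have hL1 : L ≤ 1 + Real.log M := rpow_le_one_add hlM0.le (by linarith) (by linarith)
  set t₁ : ℝ := M * Real.log N / (W ^ (1 / 2 : ℝ) * L) with ht₁
  set t₂ : ℝ := M ^ (1 / 2 + ε) * N ^ (1 / 2 : ℝ) * Real.log N ^ (1 / 2 : ℝ)
    / Real.log M ^ ((1 - α) / 2) with ht₂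
  have ht₁0 : 0 ≤ t₁ := by positivity
  have ht₂0 : 0 ≤ t₂ := by positivity
  set S := ‖∑ n ∈ Finset.Ioc ⌊W⌋₊ ⌊N⌋₊, ∑ m ∈ Finset.Icc 1 ⌊M⌋₊,
    a n / (n : ℂ) * b m * ((f m : ℝ) : ℂ) * ((jacobiSym (n : ℤ) m : ℤ) : ℂ)‖ with hS
  rcases lt_or_ge M M₀ with hsmall | hlarge
  · have h1 : S ≤ ⌊N⌋₊ * ⌊M⌋₊ := norm_bilinear_le_mul hf hf0 hf1 hfp _ _ _ a b ha hb
    have h2 : S ≤ M₀ * M := by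
      refine h1.trans (mul_le_mul ?_ (Nat.floor_le hM0.le) (by positivity) (by positivity))
      exact (Nat.floor_le hN0.le).trans (by linarith)
    have hWs : W ^ (1 / 2 : ℝ) ≤ M₀ := by
      calc W ^ (1 / 2 : ℝ) ≤ W ^ (1 : ℝ) :=
            Real.rpow_le_rpow_of_exponent_le (by linarith) (by norm_num)
        _ = W := Real.rpow_one W
        _ ≤ M₀ := by linarith
    have hLs : L ≤ 1 + M₀ := by
      have := Real.log_le_sub_one_of_pos hM0
      linarith
    have h3 : M₀ * M ≤ 2 * M₀ ^ 2 * (1 + M₀) * t₁ := by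
      have h4 : M * Real.log N / (M₀ * (1 + M₀)) ≤ t₁ := by
        rw [ht₁]; gcongr
      calc M₀ * M ≤ M₀ * M * (2 * Real.log N) :=
            le_mul_of_one_le_right (by positivity) (by linarith)
        _ = 2 * M₀ ^ 2 * (1 + M₀) * (M * Real.log N / (M₀ * (1 + M₀))) := by field_simp
        _ ≤ _ := by gcongr
    have h5 : 0 ≤ 2 * M₀ ^ 2 * (1 + M₀) * t₂ := by positivity
    have h6 : 0 ≤ (1 + C₂) * (t₁ + t₂) := by positivity
    linarith
  · set z : ℝ := M ^ η with hz
    have hz2 : 2 ≤ z := by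
      calc (2 : ℝ) = M₀ ^ η := by
            rw [hM₀, ← Real.rpow_mul (by norm_num), one_div_mul_cancel hη0.ne', Real.rpow_one]
        _ ≤ z := Real.rpow_le_rpow (by positivity) hlarge hη0.le
    have hD1 : 1 ≤ z ^ 7 := one_le_pow₀ (by linarith)
    have hD4 : (z ^ 7) ^ 4 = M ^ μ := by
      rw [← pow_mul, hz, ← Real.rpow_natCast, ← Real.rpow_mul hM0.le, hη]
      congr 1; push_cast; ring
    have hlz : Real.log z = η * Real.log M := Real.log_rpow hM0 η
    set P := oddPrimes z with hP
    have hPp : ∀ p ∈ P, p.Prime := fun p => prime_of_mem_oddPrimes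
    have hP3 : ∀ p ∈ P, 3 ≤ p := fun p => three_le_of_mem_oddPrimes
    have hG : c * L ≤ selbergG P (fun p => 1 - f p) (z ^ 7) := by
      refine le_trans ?_ (selbergG_oddPrimes_ge hz2 hf0 hf1 (hK z hz2))
      rw [hlz, Real.mul_rpow hη0.le hlM0.le, hc, mul_assoc]
      gcongr
      have := Real.rpow_le_rpow_of_exponent_ge hη0 hη1 (by linarith : 1 - α ≤ 1)
      rwa [Real.rpow_one] at this
    -- Uniformly in `α`, `L ≤ 1 + log M ≤ 2 √M`, so the sieve error is dominated by `M / L`.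
    have hMh : M ^ (1 / 2 : ℝ) ≤ 2 * (M / L) := by
      rw [← Real.sqrt_eq_rpow, ← mul_div_assoc, le_div_iff₀ hL0]
      have hs : 0 < √M := Real.sqrt_pos.mpr hM0
      have h1 : L ≤ 2 * √M := by
        have h2 := Real.log_le_sub_one_of_pos hs
        rw [Real.log_sqrt hM0.le] at h2
        linarith
      calc √M * L ≤ √M * (2 * √M) := by gcongr
        _ = 2 * (√M * √M) := by ring
        _ = 2 * M := by rw [Real.mul_self_sqrt hM0.le]
    have hT : ∑ m ∈ (Finset.Icc 1 ⌊M⌋₊).filter Odd,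
        selbergMajorant P (fun p => 1 - f p) (z ^ 7) m ≤ C₁ * (M / L) := by
      refine (sum_selbergMajorant_le hPp hP3 (fun p hp => by linarith [hf1 p (hPp p hp)])
        (fun p _ => by linarith [hf0 p]) hD1 hM0.le).trans ?_
      rw [hD4, hC₁, add_mul]
      refine add_le_add ?_ ?_
      · calc _ ≤ M / (2 * (c * L)) := by gcongr
          _ = _ := by field_simp
      · exact (Real.rpow_le_rpow_of_exponent_le (by linarith) hμh).trans hMh
    have hmain := normSq_bilinear_le hPp hP3 hD1 hf hf0 hf1 hfp hW0 ⌊N⌋₊ ⌊M⌋₊ a b ha hb hae hbe hT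
    rw [← hS, hD4] at hmain
    have hfN : (⌊N⌋₊ : ℝ) ≤ N := Nat.floor_le hN0.le
    have hfN0 : (0 : ℝ) < ⌊N⌋₊ := by
      exact_mod_cast Nat.floor_pos.mpr (by linarith)
    have hlfN : Real.log (⌊N⌋₊ : ℝ) ≤ Real.log N := Real.log_le_log hfN0 hfN
    have hlfN0 : 0 ≤ Real.log (⌊N⌋₊ : ℝ) := Real.log_natCast_nonneg _
    have ht₁sq : t₁ ^ 2 = (M / L) ^ 2 * (Real.log N ^ 2 / W) := by
      rw [ht₁, ← Real.sqrt_eq_rpow, div_pow, mul_pow (√W), Real.sq_sqrt hW0.le]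
      field_simp
    have ht₂sq : t₂ ^ 2 = (M / L) * (M ^ (2 * ε) * (N * Real.log N)) := by
      have e1 : ∀ x s : ℝ, 0 < x → (x ^ s) ^ 2 = x ^ (2 * s) := by
        intro x s hx
        rw [← Real.rpow_natCast, ← Real.rpow_mul hx.le]; congr 1; push_cast; ring
      rw [ht₂, div_pow, mul_pow, mul_pow, e1 _ _ hM0, e1 _ _ hN0, e1 _ _ (by linarith), e1 _ _ hlM0,
        show 2 * (1 / 2 + ε) = 1 + 2 * ε by ring, Real.rpow_add hM0, Real.rpow_one,
        show (2 : ℝ) * (1 / 2) = 1 by norm_num, Real.rpow_one, Real.rpow_one,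
        show 2 * ((1 - α) / 2) = 1 - α by ring]
      ring
    have hML : 0 ≤ M / L := by positivity
    have hA : C₁ * (M / L) * (C₁ * (M / L) * (4 / W * (1 + Real.log ⌊N⌋₊)))
        ≤ 24 * C₁ ^ 2 * t₁ ^ 2 := by
      have h1 : 1 + Real.log (⌊N⌋₊ : ℝ) ≤ 6 * Real.log N ^ 2 :=
        (add_le_add_right hlfN 1).trans (one_add_le_six_mul_sq hlN)
      calc _ ≤ C₁ * (M / L) * (C₁ * (M / L) * (4 / W * (6 * Real.log N ^ 2))) := by gcongr
        _ = _ := by rw [ht₁sq]; ring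
    have hB : C₁ * (M / L) * (M ^ μ * (8 * (⌊N⌋₊ * (1 + 2 * Real.log ⌊N⌋₊))))
        ≤ 32 * C₁ * t₂ ^ 2 := by
      have h1 : 1 + 2 * Real.log (⌊N⌋₊ : ℝ) ≤ 4 * Real.log N := by linarith
      have h2 : M ^ μ ≤ M ^ (2 * ε) := Real.rpow_le_rpow_of_exponent_le (by linarith) hμε
      calc _ ≤ C₁ * (M / L) * (M ^ (2 * ε) * (8 * (N * (4 * Real.log N)))) := by gcongr
        _ = _ := by rw [ht₂sq]; ring
    have h4 : S ≤ (1 + C₂) * (t₁ + t₂) := by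
      refine le_mul_add_of_sq_le (by positivity) (by positivity) ht₁0 ht₂0 (hmain.trans ?_)
      rw [mul_add]
      exact add_le_add hA hB
    have h5 : 0 ≤ 2 * M₀ ^ 2 * (1 + M₀) * (t₁ + t₂) := by positivity
    linarith
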